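/- Let $1<p<\infty$, let $\sigma>0$, and let $f\colon\mathbb{R}\to\mathbb{C}$ belong to the Bernstein space $B^p_\sigma$; that is, $f\in L^p(\mathbb{R})$ and the distributional Fourier transform $\hat f$ of $f$ vanishes outside $[-\sigma,\sigma]$, where the Fourier transform is normalized by $\hat g(x)=\int_{\mathbb{R}} g(t)e^{-ixt}\,dt$ for $g\in L^1(\mathbb{R})$. For $\tau>0$ let $N=\lfloor \sigma\tau/\pi\rfloor$, $$c_{k,\tau}=\frac1{2\tau}\int_{-\tau}^{\tau}f(t)e^{-i\frac{\pi}{\tau}kt}\,dt,\qquad f_\tau(x)=\sum_{k=-N}^{N}c_{k,\tau}\,e^{i\frac{\pi}{\tau}kx},\qquad \varphi_{f,\tau}=f_\tau\cdot\chi_{[-\tau,\tau]},$$ where $\chi_{[-\tau,\tau]}$ is the indicator function of $[-\tau,\tau]$. Then $$\lim_{\tau\to\infty}\|f-\varphi_{f,\tau}\|_{L^p(\mathbb{R})}=0 .$$ -/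

import Mathlib

open MeasureTheory Filter Topology
open scoped ENNReal SchwartzMap

noncomputable section

/-- The Fourier transform of an integrable function, with angular-frequency normalization
`ĝ(x) = ∫ g(t) e^{-ixt} dt`. -/
def angularFourier (g : ℝ → ℂ) (x : ℝ) : ℂ :=
  ∫ t : ℝ, g t * Complex.exp (-(Complex.I * x * t))

/-- The distributional Fourier transform of a function `f` (in some `L^p`), as a functional on
Schwartz functions: `⟨f̂, g⟩ = ⟨f, ĝ⟩ = ∫ f(x) ĝ(x) dx`. -/
def distributionalFourier (f : ℝ → ℂ) (g : 𝓢(ℝ, ℂ)) : ℂ :=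
  ∫ x : ℝ, f x * angularFourier g x

/-- `f` is bandlimited to `[-σ, σ]`: its distributional Fourier transform vanishes on the open set
`ℝ \ [-σ, σ]`, that is, on every test function supported there. -/
def IsBandlimited (σ : ℝ) (f : ℝ → ℂ) : Prop :=
  Distribution.IsVanishingOn (distributionalFourier f) (Set.Icc (-σ) σ)ᶜ

/-- Membership in the Bernstein space `B^p_σ`. -/
structure MemBernstein (p : ℝ≥0∞) (σ : ℝ) (f : ℝ → ℂ) : Prop where
  memLp : MemLp f p volume
  isBandlimited : IsBandlimited σ f

/-- The Fourier coefficient `c_{k,τ}` of `f` on `[-τ, τ]`. -/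
def fourierCoeffInterval (f : ℝ → ℂ) (τ : ℝ) (k : ℤ) : ℂ :=
  (1 / (2 * (τ : ℂ))) *
    ∫ t in (-τ)..τ, f t * Complex.exp (-(Complex.I * (Real.pi / τ) * k * t))

/-- The trigonometric sum `f_τ`, of degree `N = ⌊στ/π⌋`. -/
def trigSum (σ : ℝ) (f : ℝ → ℂ) (τ : ℝ) (x : ℝ) : ℂ :=
  ∑ k ∈ Finset.Icc (-⌊σ * τ / Real.pi⌋) ⌊σ * τ / Real.pi⌋,
    fourierCoeffInterval f τ k * Complex.exp (Complex.I * (Real.pi / τ) * k * x)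

/-- The truncated sum `φ_{f,τ} = f_τ · χ_{[-τ, τ]}`. -/
def truncatedTrigSum (σ : ℝ) (f : ℝ → ℂ) (τ : ℝ) : ℝ → ℂ :=
  (Set.Icc (-τ) τ).indicator (trigSum σ f τ)

end

/-!
The convergence comes from a uniform bound together with convergence on a dense class.

**Uniform bound.** On `[-τ, τ]` the map `f ↦ f_τ` is a symmetric partial sum operator of Fourier
series, so M. Riesz's theorem (`exists_eLpNorm_fourierPartialSum_le`, and
`exists_eLpNorm_trigSum_le` on the interval) bounds it on `L ^ p` by a constant independent of the
degree and, by scale invariance, of `τ`. For `1 < p ≤ 2` the theorem is derived from the conjugate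
function inequality for analytic polynomials `P`. If `Re P > 0`, then `P ^ p` is holomorphic and the
pointwise estimate `|z| ^ p ≤ a (Re z) ^ p - b Re (z ^ p)` can be integrated with the mean value
property. In general `P` is a difference of two such polynomials, obtained by approximating the
positive part of `Re P` uniformly. This bounds the Riesz projection on trigonometric polynomials,
then, by modulation, the partial sums; density extends the bound to all of `L ^ p`, and duality
to `p > 2`.

**Dense class.** If `G` is a Schwartz function with spectrum in `[-σ, σ]`, Poisson summation shows
that its `2τ`-periodization `P` is a trigonometric polynomial of degree at most `⌊σ τ / π⌋`, which is
reproduced by its partial sum. Hence `G - G_τ = (G - P) - (G - P)_τ` on `[-τ, τ]`, where `G - P` is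
small by the decay of `G`. Such `G` are dense in the Bernstein space
(`MemBernstein.exists_schwartz_eLpNorm_sub_le`): take `G x = f ((1 - s) x) Ψ (σ s x / 2π)`, where `Ψ`
is the Fourier transform of a bump function with integral one supported in `[-1, 1]`, and let
`s → 0`.
-/

section

open scoped NNReal ComplexConjugate FourierTransform

open AddCircle (haarAddCircle toCircle)

/-! ### Positive real part: a pointwise estimate and mean values -/

/-- On the right half-plane `|z| ^ p` is dominated by `a (Re z) ^ p` minus a multiple of the
harmonic function `Re (z ^ p)`: near the imaginary axis `Re (z ^ p)` is itself negative of size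
`|z| ^ p`, because `π / 2 < p |arg z| ≤ π` there, and elsewhere `Re z` is comparable to `|z|`. -/
theorem norm_rpow_le_re_rpow_sub_re_cpow {p : ℝ} (hp1 : 1 < p) (hp2 : p ≤ 2) :
    ∃ a b : ℝ, 0 ≤ a ∧ 0 ≤ b ∧ ∀ z : ℂ, 0 < z.re →
      ‖z‖ ^ p ≤ a * z.re ^ p - b * (z ^ (p : ℂ)).re := by
  have hπ := Real.pi_pos
  -- an angle `θ₀ < π / 2` with `p θ₀ > π / 2`
  obtain ⟨θ₀, h1, h2⟩ : ∃ θ₀, Real.pi / (2 * p) < θ₀ ∧ θ₀ < Real.pi / 2 := by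
    apply exists_between
    rw [div_lt_div_iff₀ (by positivity) (by positivity)]
    nlinarith
  have hθ0 : 0 < θ₀ := lt_trans (by positivity) h1
  have h3 : Real.pi / 2 < θ₀ * p := by
    rw [div_lt_iff₀ (by positivity)] at h1
    linarith
  have h4 : θ₀ * p < Real.pi := by nlinarith
  have hc : Real.cos (θ₀ * p) < 0 := Real.cos_neg_of_pi_div_two_lt_of_lt h3 (by linarith)
  have hc0 : 0 < Real.cos θ₀ := Real.cos_pos_of_mem_Ioo ⟨by linarith, h2⟩
  set b := -(Real.cos (θ₀ * p))⁻¹ with hb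
  have hb0 : 0 ≤ b := by
    rw [hb, neg_nonneg]; exact (inv_lt_zero.2 hc).le
  refine ⟨(1 + b) / Real.cos θ₀ ^ p, b, by positivity, hb0, fun z hz => ?_⟩
  have hz0 : 0 < ‖z‖ := norm_pos_iff.2 (by rintro rfl; simp at hz)
  have hre : z.re = ‖z‖ * Real.cos |z.arg| := by rw [Real.cos_abs, Complex.norm_mul_cos_arg]
  have harg : |z.arg| < Real.pi / 2 := Complex.abs_arg_lt_pi_div_two_iff.2 (Or.inl hz)
  have hcpow : (z ^ (p : ℂ)).re = ‖z‖ ^ p * Real.cos (|z.arg| * p) := by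
    rw [Complex.cpow_ofReal_re, ← Real.cos_abs (z.arg * p), abs_mul, abs_of_pos (by linarith : 0 < p)]
  have hcos : 0 < Real.cos |z.arg| :=
    Real.cos_pos_of_mem_Ioo ⟨by linarith [abs_nonneg z.arg], harg⟩
  rw [hcpow, hre, Real.mul_rpow hz0.le hcos.le]
  have hzp : 0 < ‖z‖ ^ p := by positivity
  suffices 1 ≤ (1 + b) / Real.cos θ₀ ^ p * Real.cos |z.arg| ^ p - b * Real.cos (|z.arg| * p) by
    nlinarith
  rcases le_total |z.arg| θ₀ with h | h
  · have : Real.cos θ₀ ≤ Real.cos |z.arg| :=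
      Real.cos_le_cos_of_nonneg_of_le_pi (abs_nonneg _) (by linarith) h
    have : 1 ≤ Real.cos |z.arg| ^ p / Real.cos θ₀ ^ p := by
      rw [one_le_div (by positivity)]
      gcongr
    have h5 : (1 + b) / Real.cos θ₀ ^ p * Real.cos |z.arg| ^ p
      = (1 + b) * (Real.cos |z.arg| ^ p / Real.cos θ₀ ^ p) := by ring
    have h6 := Real.cos_le_one (|z.arg| * p)
    rw [h5]
    nlinarith
  · have : Real.cos (|z.arg| * p) ≤ Real.cos (θ₀ * p) :=
      Real.cos_le_cos_of_nonneg_of_le_pi (by positivity) (by nlinarith) (by nlinarith)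
    have h5 : b * Real.cos (θ₀ * p) = -1 := by
      rw [hb, neg_mul, inv_mul_cancel₀ hc.ne]
    have : 0 ≤ (1 + b) / Real.cos θ₀ ^ p * Real.cos |z.arg| ^ p := by positivity
    nlinarith

/-- Integrals over `ℝ / Tℤ` with normalized measure are averages over the unit circle of `ℂ`, for
every period `T`; this is why all constants below are independent of `T`. -/
theorem AddCircle.integral_comp_toCircle {T : ℝ} [hT : Fact (0 < T)] (F : ℂ → ℂ) :
    ∫ x : AddCircle T, F (AddCircle.toCircle x) ∂AddCircle.haarAddCircle
      = Real.circleAverage F 0 1 := by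
  have hT0 := hT.out
  rw [AddCircle.integral_haarAddCircle, ← AddCircle.intervalIntegral_preimage T 0, zero_add,
    Real.circleAverage_def]
  have h : ∀ x : ℝ, F (AddCircle.toCircle (x : AddCircle T))
      = (fun θ => F (circleMap 0 1 θ)) (2 * Real.pi / T * x) := fun x => by
    simp [AddCircle.toCircle_apply_mk, Circle.coe_exp, circleMap]
  simp_rw [h]
  rw [intervalIntegral.integral_comp_mul_left (fun θ => F (circleMap 0 1 θ)) (by positivity),
    smul_smul]
  congr 1
  · field_simp
  · simp
    field_simp

/-- Minimum principle for the harmonic function `Re P`, through the maximum principle for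
`exp (-P)`. -/
theorem Polynomial.re_eval_pos_of_mem_closedBall {P : Polynomial ℂ}
    (hP : ∀ z ∈ Metric.sphere (0 : ℂ) 1, 0 < (P.eval z).re) {z : ℂ}
    (hz : z ∈ Metric.closedBall (0 : ℂ) 1) : 0 < (P.eval z).re := by
  obtain ⟨w, hw, hmin⟩ := (isCompact_sphere (0 : ℂ) 1).exists_isMinOn
    (NormedSpace.sphere_nonempty.2 zero_le_one)
    (f := fun z => (P.eval z).re) (Complex.continuous_re.comp P.continuous).continuousOn
  have key : ‖Complex.exp (-P.eval z)‖ ≤ Real.exp (-(P.eval w).re) := by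
    apply Complex.norm_le_of_forall_mem_frontier_norm_le (U := Metric.ball (0 : ℂ) 1)
      (f := fun z => Complex.exp (-P.eval z)) Metric.isBounded_ball
    · apply Differentiable.diffContOnCl
      exact (P.differentiable.neg).cexp
    · intro y hy
      rw [frontier_ball _ one_ne_zero] at hy
      simp only [Complex.norm_exp, Complex.neg_re, Real.exp_le_exp, neg_le_neg_iff]
      exact hmin hy
    · rwa [closure_ball _ one_ne_zero]
  rw [Complex.norm_exp, Real.exp_le_exp, Complex.neg_re] at key
  linarith [hP w hw]

/-- The mean value property of `P ^ p`, which is holomorphic in the disc because `Re P > 0` there. -/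
theorem Polynomial.integral_cpow_toCircle {T : ℝ} [hT : Fact (0 < T)] {P : Polynomial ℂ}
    (hP : ∀ z ∈ Metric.sphere (0 : ℂ) 1, 0 < (P.eval z).re) (p : ℂ) :
    ∫ x : AddCircle T, (P.eval (AddCircle.toCircle x : ℂ)) ^ p ∂AddCircle.haarAddCircle
      = P.eval 0 ^ p := by
  rw [AddCircle.integral_comp_toCircle (fun z => P.eval z ^ p)]
  refine DiffContOnCl.circleAverage (f := fun z => P.eval z ^ p) ⟨?_, ?_⟩
  · intro z hz
    refine (DifferentiableAt.cpow_const P.differentiable.differentiableAt ?_).differentiableWithinAt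
    exact Or.inl (re_eval_pos_of_mem_closedBall hP (Metric.ball_subset_closedBall (by simpa using hz)))
  · rw [abs_one, closure_ball _ one_ne_zero]
    refine P.continuous.continuousOn.cpow_const fun z hz => ?_
    exact Or.inl (re_eval_pos_of_mem_closedBall hP hz)

/-! ### The conjugate function inequality for polynomials -/

theorem Continuous.memLp_haarAddCircle {T : ℝ} [Fact (0 < T)] {E : Type*} [NormedAddCommGroup E]
    [SecondCountableTopologyEither (AddCircle T) E]
    {f : AddCircle T → E} (hf : Continuous f) (p : ℝ≥0∞) : MemLp f p haarAddCircle := by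
  obtain ⟨C, hC⟩ := isCompact_univ.exists_bound_of_continuousOn hf.continuousOn
  exact MemLp.of_bound hf.aestronglyMeasurable C (.of_forall fun x => hC x trivial)

theorem Continuous.eLpNorm_haarAddCircle {T : ℝ} [Fact (0 < T)] {E : Type*} [NormedAddCommGroup E]
    [SecondCountableTopologyEither (AddCircle T) E]
    {f : AddCircle T → E} (hf : Continuous f) {p : ℝ} (hp : 0 < p) :
    eLpNorm f (.ofReal p) haarAddCircle
      = .ofReal ((∫ x, ‖f x‖ ^ p ∂haarAddCircle) ^ p⁻¹) := by
  have hp' : ENNReal.ofReal p ≠ 0 := by simpa using hp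
  rw [(hf.memLp_haarAddCircle _).eLpNorm_eq_integral_rpow_norm hp' ENNReal.ofReal_ne_top,
    ENNReal.toReal_ofReal hp.le]

theorem Polynomial.continuous_eval_toCircle {T : ℝ} (P : Polynomial ℂ) :
    Continuous fun x : AddCircle T => P.eval (toCircle x : ℂ) :=
  P.continuous.comp (continuous_subtype_val.comp AddCircle.continuous_toCircle)

/-- The conjugate function inequality when the real part is positive: integrate
`norm_rpow_le_re_rpow_sub_re_cpow` over the circle; the term with `Re (P ^ p)` contributes
`P 0 ^ p ≥ 0` and can be dropped. -/
theorem Polynomial.exists_eLpNorm_le_of_re_pos {p : ℝ} (hp1 : 1 < p) (hp2 : p ≤ 2) :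
    ∃ C : ℝ≥0, ∀ (T : ℝ) [Fact (0 < T)] (P : Polynomial ℂ), (P.eval 0).im = 0 →
      (∀ z ∈ Metric.sphere (0 : ℂ) 1, 0 < (P.eval z).re) →
      eLpNorm (fun x : AddCircle T => P.eval (toCircle x : ℂ)) (.ofReal p) haarAddCircle ≤
        C * eLpNorm (fun x : AddCircle T => (P.eval (toCircle x : ℂ)).re) (.ofReal p)
          haarAddCircle := by
  obtain ⟨a, b, ha, hb, hab⟩ := norm_rpow_le_re_rpow_sub_re_cpow hp1 hp2
  have hp0 : 0 < p := by linarith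
  refine ⟨(a ^ p⁻¹).toNNReal, fun T _ P hP0 hP => ?_⟩
  have hPc := P.continuous_eval_toCircle (T := T)
  have hPre : Continuous fun x : AddCircle T => (P.eval (toCircle x : ℂ)).re :=
    Complex.continuous_re.comp hPc
  have hpos : ∀ x : AddCircle T, 0 < (P.eval (toCircle x : ℂ)).re := fun x =>
    hP _ (by rw [mem_sphere_zero_iff_norm]; exact Circle.norm_coe _)
  have hint : ∀ {E : Type} [NormedAddCommGroup E] {f : AddCircle T → E}
      [SecondCountableTopologyEither (AddCircle T) E],
      Continuous f → Integrable f haarAddCircle :=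
    fun hf => memLp_one_iff_integrable.1 (hf.memLp_haarAddCircle 1)
  have hcpow : Continuous fun x : AddCircle T => P.eval (toCircle x : ℂ) ^ (p : ℂ) :=
    hPc.cpow continuous_const fun x => Or.inl (hpos x)
  have hrpow : Continuous fun x : AddCircle T => (P.eval (toCircle x : ℂ)).re ^ p :=
    hPre.rpow_const fun x => Or.inr hp0.le
  have hP0' : 0 ≤ (P.eval 0 ^ (p : ℂ)).re := by
    have h0 := re_eval_pos_of_mem_closedBall hP (Metric.mem_closedBall_self zero_le_one)
    have : P.eval 0 = ((P.eval 0).re : ℂ) := by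
      apply Complex.ext <;> simp [hP0]
    rw [this, ← Complex.ofReal_cpow h0.le, Complex.ofReal_re]
    positivity
  have key : ∫ x : AddCircle T, ‖P.eval (toCircle x : ℂ)‖ ^ p ∂haarAddCircle
      ≤ a * ∫ x : AddCircle T, ‖(P.eval (toCircle x : ℂ)).re‖ ^ p ∂haarAddCircle := by
    calc ∫ x : AddCircle T, ‖P.eval (toCircle x : ℂ)‖ ^ p ∂haarAddCircle
        ≤ ∫ x : AddCircle T, (a * (P.eval (toCircle x : ℂ)).re ^ p
            - b * (P.eval (toCircle x : ℂ) ^ (p : ℂ)).re) ∂haarAddCircle := by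
          refine integral_mono (hint (hPc.norm.rpow_const fun x => Or.inr hp0.le))
            (((hint hrpow).const_mul a).sub
              ((hint (Complex.continuous_re.comp hcpow)).const_mul b)) fun x => hab _ (hpos x)
      _ = a * ∫ x : AddCircle T, (P.eval (toCircle x : ℂ)).re ^ p ∂haarAddCircle
            - b * (P.eval 0 ^ (p : ℂ)).re := by
          refine (integral_sub ((hint hrpow).const_mul a)
            ((hint (Complex.continuous_re.comp hcpow)).const_mul b)).trans ?_
          rw [integral_const_mul, integral_const_mul, ← integral_cpow_toCircle (T := T) hP]
          congr 2
          exact integral_re (hint hcpow)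
      _ ≤ a * ∫ x : AddCircle T, ‖(P.eval (toCircle x : ℂ)).re‖ ^ p ∂haarAddCircle := by
          simp only [Real.norm_eq_abs, abs_of_pos (hpos _)]
          nlinarith [mul_nonneg hb hP0']
  rw [hPc.eLpNorm_haarAddCircle hp0, hPre.eLpNorm_haarAddCircle hp0, ENNReal.ofNNReal_toNNReal,
    ← ENNReal.ofReal_mul (by positivity), ← Real.mul_rpow ha (integral_nonneg fun _ => by positivity)]
  gcongr

/-- A trigonometric polynomial is the sum of an analytic polynomial, from its frequencies `≥ 0`, and
a conjugate analytic one vanishing at `0`, from its negative frequencies. -/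
theorem exists_polynomial_eq_add_conj {T : ℝ} {g : C(AddCircle T, ℂ)}
    (hg : g ∈ Submodule.span ℂ (Set.range (@fourier T))) :
    ∃ A B : Polynomial ℂ, B.eval 0 = 0 ∧
      ∀ x, g x = A.eval (toCircle x : ℂ) + conj (B.eval (toCircle x : ℂ)) := by
  induction hg using Submodule.span_induction with
  | mem g hg =>
    obtain ⟨n, rfl⟩ := hg
    rcases le_or_gt 0 n with h | h
    · lift n to ℕ using h
      exact ⟨.X ^ n, 0, by simp, fun x => by simp [AddCircle.toCircle_nsmul]⟩
    · obtain ⟨m, rfl⟩ : ∃ m : ℕ, n = -m := ⟨n.natAbs, by omega⟩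
      refine ⟨0, .X ^ m, by simp; omega, fun x => ?_⟩
      rw [fourier_neg]
      simp [AddCircle.toCircle_nsmul]
  | zero => exact ⟨0, 0, by simp, by simp⟩
  | add g h _ _ hg hh =>
    obtain ⟨A, B, hB, hg⟩ := hg
    obtain ⟨A', B', hB', hh⟩ := hh
    refine ⟨A + A', B + B', by simp [hB, hB'], fun x => ?_⟩
    simp [hg, hh]; ring
  | smul a g _ hg =>
    obtain ⟨A, B, hB, hg⟩ := hg
    refine ⟨.C a * A, .C (conj a) * B, by simp [hB], fun x => ?_⟩
    simp [hg]; ring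

/-- Real parts of analytic polynomials are uniformly dense in the real continuous functions on the
circle. -/
theorem exists_polynomial_re_near {T : ℝ} [Fact (0 < T)] {u : AddCircle T → ℝ} (hu : Continuous u)
    {ε : ℝ} (hε : 0 < ε) :
    ∃ P : Polynomial ℂ, (P.eval 0).im = 0 ∧ ∀ x, |(P.eval (toCircle x : ℂ)).re - u x| < ε := by
  let U : C(AddCircle T, ℂ) := ⟨fun x => u x, Complex.continuous_ofReal.comp hu⟩
  have hU : U ∈ (Submodule.span ℂ (Set.range (@fourier T))).topologicalClosure := by
    rw [span_fourier_closure_eq_top]; trivial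
  obtain ⟨g, hg, hgU⟩ := Metric.mem_closure_iff.1 hU ε hε
  obtain ⟨A, B, -, hAB⟩ := exists_polynomial_eq_add_conj hg
  refine ⟨A + B - .C (((A + B).eval 0).im * Complex.I), by simp, fun x => ?_⟩
  rw [dist_comm, dist_eq_norm] at hgU
  have h1 := (ContinuousMap.norm_coe_le_norm (g - U) x).trans_lt hgU
  have h2 := (Complex.abs_re_le_norm _).trans_lt h1
  simpa [hAB, U] using h2

/-- The conjugate function inequality for polynomials: `P` is written as a difference of two
polynomials with positive real part, close to the positive and negative parts of `Re P`. -/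
theorem Polynomial.exists_eLpNorm_le_re {p : ℝ} (hp1 : 1 < p) (hp2 : p ≤ 2) :
    ∃ C : ℝ≥0, ∀ (T : ℝ) [Fact (0 < T)] (P : Polynomial ℂ), (P.eval 0).im = 0 →
      eLpNorm (fun x : AddCircle T => P.eval (toCircle x : ℂ)) (.ofReal p) haarAddCircle ≤
        C * eLpNorm (fun x : AddCircle T => (P.eval (toCircle x : ℂ)).re) (.ofReal p)
          haarAddCircle := by
  obtain ⟨C, hC⟩ := exists_eLpNorm_le_of_re_pos hp1 hp2
  refine ⟨2 * C, fun T _ P hP0 => ?_⟩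
  have hp1' : 1 ≤ ENNReal.ofReal p := by simpa using hp1.le
  have hp0' : ENNReal.ofReal p ≠ 0 := (zero_lt_one.trans_le hp1').ne'
  set u : AddCircle T → ℝ := fun x => (P.eval (toCircle x : ℂ)).re with hu
  have huc : Continuous u := Complex.continuous_re.comp P.continuous_eval_toCircle
  -- a polynomial `Q` with `Re Q > 0`, `Re (Q - P) > 0`, both at most `|u| + ε` on the circle
  have key : ∀ ε : ℝ≥0, 0 < ε → eLpNorm (fun x : AddCircle T => P.eval (toCircle x : ℂ)) (.ofReal p)
      haarAddCircle ≤ (2 * C : ℝ≥0) * (eLpNorm u (.ofReal p) haarAddCircle + ε) := by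
    intro ε hε
    have hε' : (0 : ℝ) < ε := hε
    obtain ⟨Q, hQ0, hQ⟩ := exists_polynomial_re_near (u := fun x => max (u x) 0 + ε / 2)
      ((huc.max continuous_const).add continuous_const) (half_pos hε')
    have bound : ∀ R : Polynomial ℂ, (R.eval 0).im = 0 →
        (∀ x : AddCircle T, 0 < (R.eval (toCircle x : ℂ)).re) →
        (∀ x : AddCircle T, (R.eval (toCircle x : ℂ)).re ≤ |u x| + ε) →
        eLpNorm (fun x : AddCircle T => R.eval (toCircle x : ℂ)) (.ofReal p) haarAddCircle ≤
          C * (eLpNorm u (.ofReal p) haarAddCircle + ε) := by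
      intro R hR0 hRpos hRle
      refine (hC T R hR0 ?_).trans ?_
      · intro z hz
        obtain ⟨x, hx⟩ := (AddCircle.homeomorphCircle (T := T) (Fact.out : 0 < T).ne').surjective
          ⟨z, by simpa [Submonoid.unitSphere] using hz⟩
        have := hRpos x
        rw [← AddCircle.homeomorphCircle_apply (Fact.out : 0 < T).ne', hx] at this
        exact this
      gcongr
      calc _ ≤ eLpNorm (fun x => |u x| + (ε : ℝ)) (.ofReal p) haarAddCircle := by
            refine eLpNorm_mono_real fun x => ?_
            rw [Real.norm_eq_abs, abs_of_pos (hRpos x)]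
            exact hRle x
        _ ≤ eLpNorm (fun x => |u x|) (.ofReal p) haarAddCircle
              + eLpNorm (fun _ : AddCircle T => (ε : ℝ)) (.ofReal p) haarAddCircle :=
            eLpNorm_add_le huc.abs.aestronglyMeasurable aestronglyMeasurable_const hp1'
        _ = _ := by
            congr 1
            · exact eLpNorm_norm u
            · rw [eLpNorm_const _ hp0' (NeZero.ne _)]
              simp
    have h1 := bound Q hQ0 (fun x => ?_) (fun x => ?_)
    have h2 := bound (Q - P) (by simp [hQ0, hP0]) (fun x => ?_) (fun x => ?_)
    · calc _ = eLpNorm ((fun x : AddCircle T => Q.eval (toCircle x : ℂ))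
              - fun x => (Q - P).eval (toCircle x : ℂ)) (.ofReal p) haarAddCircle := by
            congr 1; ext x; simp
        _ ≤ _ := eLpNorm_sub_le Q.continuous_eval_toCircle.aestronglyMeasurable
            (Q - P).continuous_eval_toCircle.aestronglyMeasurable hp1'
        _ ≤ _ := add_le_add h1 h2
        _ = _ := by push_cast; ring
    all_goals
      have := abs_lt.1 (hQ x)
      have hQP : ((Q - P).eval (toCircle x : ℂ)).re = (Q.eval (toCircle x : ℂ)).re - u x := by
        rw [eval_sub, Complex.sub_re]
      try rw [hQP]
      rcases le_total (u x) 0 with h | h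
      · rw [max_eq_right h] at this
        try rw [abs_of_nonpos h]
        linarith
      · rw [max_eq_left h] at this
        try rw [abs_of_nonneg h]
        linarith
  have hlim : Tendsto (fun ε : ℝ≥0 => ((2 * C : ℝ≥0) : ℝ≥0∞)
      * (eLpNorm u (.ofReal p) haarAddCircle + (ε : ℝ≥0∞))) (𝓝[>] 0)
      (𝓝 ((2 * C : ℝ≥0) * (eLpNorm u (.ofReal p) haarAddCircle + ((0 : ℝ≥0) : ℝ≥0∞)))) := by
    refine ENNReal.Tendsto.const_mul ?_ (Or.inr ENNReal.coe_ne_top)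
    refine tendsto_const_nhds.add ?_
    exact (ENNReal.tendsto_coe.2 tendsto_id).mono_left nhdsWithin_le_nhds
  simp only [ENNReal.coe_zero, add_zero] at hlim
  exact ge_of_tendsto hlim (eventually_nhdsWithin_of_forall key)

/-! ### The Riesz projection and partial sums of trigonometric polynomials -/

theorem enorm_integral_haarAddCircle_le {T : ℝ} [Fact (0 < T)] {p : ℝ≥0∞} (hp : 1 ≤ p)
    {f : AddCircle T → ℂ} (hf : AEStronglyMeasurable f haarAddCircle) :
    ‖∫ x, f x ∂haarAddCircle‖ₑ ≤ eLpNorm f p haarAddCircle :=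
  (enorm_integral_le_lintegral_enorm f).trans <| by
    rw [← eLpNorm_one_eq_lintegral_enorm]
    exact eLpNorm_le_eLpNorm_of_exponent_le hp hf

/-- Boundedness of the Riesz projection on trigonometric polynomials. -/
theorem Polynomial.exists_eLpNorm_le_add_conj {p : ℝ} (hp1 : 1 < p) (hp2 : p ≤ 2) :
    ∃ C : ℝ≥0, ∀ (T : ℝ) [Fact (0 < T)] (A B : Polynomial ℂ), B.eval 0 = 0 →
      eLpNorm (fun x : AddCircle T => A.eval (toCircle x : ℂ)) (.ofReal p) haarAddCircle ≤
        C * eLpNorm (fun x : AddCircle T =>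
          A.eval (toCircle x : ℂ) + conj (B.eval (toCircle x : ℂ))) (.ofReal p) haarAddCircle := by
  obtain ⟨C, hC⟩ := exists_eLpNorm_le_re hp1 hp2
  refine ⟨2 * C + 1, fun T _ A B hB => ?_⟩
  have hp1' : 1 ≤ ENNReal.ofReal p := by simpa using hp1.le
  have hp0' : ENNReal.ofReal p ≠ 0 := (zero_lt_one.trans_le hp1').ne'
  set g : AddCircle T → ℂ :=
    fun x => A.eval (toCircle x : ℂ) + conj (B.eval (toCircle x : ℂ)) with hg
  have hAc := A.continuous_eval_toCircle (T := T)
  have hBc : Continuous fun x : AddCircle T => conj (B.eval (toCircle x : ℂ)) :=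
    Complex.continuous_conj.comp B.continuous_eval_toCircle
  have hgc : Continuous g := hAc.add hBc
  have hint : ∀ {f : AddCircle T → ℂ}, Continuous f → Integrable f haarAddCircle :=
    fun hf => memLp_one_iff_integrable.1 (hf.memLp_haarAddCircle 1)
  have hmean : ∀ P : Polynomial ℂ, ∫ x : AddCircle T, P.eval (toCircle x : ℂ) ∂haarAddCircle
      = P.eval 0 := fun P => by
    rw [AddCircle.integral_comp_toCircle (fun z => P.eval z)]
    exact P.differentiable.diffContOnCl.circleAverage
  set a₀ := A.eval 0 with ha₀
  have hga : ∫ x, g x ∂haarAddCircle = a₀ := by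
    rw [hg, integral_add (hint hAc) (hint hBc), integral_conj, hmean, hmean, hB]
    simp [ha₀]
  -- polynomials whose real parts on the circle are `Re g` and `Im g`; `2 A = F₁ + i F₂ + a₀`
  set F₁ : Polynomial ℂ := A + B - .C (a₀.im * Complex.I) with hF₁
  set F₂ : Polynomial ℂ := .C (-Complex.I) * (A - B) + .C (a₀.re * Complex.I) with hF₂
  have h₁ : eLpNorm (fun x : AddCircle T => F₁.eval (toCircle x : ℂ)) (.ofReal p) haarAddCircle
      ≤ C * eLpNorm g (.ofReal p) haarAddCircle := by
    refine (hC T F₁ (by simp [hF₁, hB, ← ha₀])).trans ?_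
    gcongr
    refine eLpNorm_mono fun x => ?_
    have : (F₁.eval (toCircle x : ℂ)).re = (g x).re := by simp [hF₁, hg]
    rw [this]
    exact Complex.abs_re_le_norm _
  have h₂ : eLpNorm (fun x : AddCircle T => F₂.eval (toCircle x : ℂ)) (.ofReal p) haarAddCircle
      ≤ C * eLpNorm g (.ofReal p) haarAddCircle := by
    refine (hC T F₂ (by simp [hF₂, hB, ← ha₀])).trans ?_
    gcongr
    refine eLpNorm_mono fun x => ?_
    have : (F₂.eval (toCircle x : ℂ)).re = (g x).im := by simp [hF₂, hg, sub_eq_add_neg]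
    rw [this]
    exact Complex.abs_im_le_norm _
  have h₃ : eLpNorm (fun _ : AddCircle T => a₀) (.ofReal p) haarAddCircle
      ≤ eLpNorm g (.ofReal p) haarAddCircle := by
    rw [eLpNorm_const _ hp0' (NeZero.ne _), measure_univ, ENNReal.one_rpow, mul_one, ← hga]
    exact enorm_integral_haarAddCircle_le hp1' hgc.aestronglyMeasurable
  have hF₁c := F₁.continuous_eval_toCircle (T := T)
  have hF₂c : Continuous fun x : AddCircle T => Complex.I * F₂.eval (toCircle x : ℂ) :=
    continuous_const.mul F₂.continuous_eval_toCircle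
  calc eLpNorm (fun x : AddCircle T => A.eval (toCircle x : ℂ)) (.ofReal p) haarAddCircle
      ≤ eLpNorm (((fun x : AddCircle T => F₁.eval (toCircle x : ℂ))
          + fun x => Complex.I * F₂.eval (toCircle x : ℂ)) + fun _ => a₀) (.ofReal p)
          haarAddCircle := by
        refine eLpNorm_mono fun x => ?_
        have : F₁.eval (toCircle x : ℂ) + Complex.I * F₂.eval (toCircle x : ℂ) + a₀
            = 2 * A.eval (toCircle x : ℂ) := by
          simp only [hF₁, hF₂, eval_add, eval_sub, eval_mul, eval_C]
          linear_combination (-(A.eval (toCircle x : ℂ)) + B.eval (toCircle x : ℂ) + a₀.re)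
            * Complex.I_mul_I - Complex.re_add_im a₀
        simp only [Pi.add_apply]
        rw [this, norm_mul, Complex.norm_ofNat]
        linarith [norm_nonneg (A.eval (toCircle x : ℂ))]
    _ ≤ (eLpNorm (fun x : AddCircle T => F₁.eval (toCircle x : ℂ)) (.ofReal p) haarAddCircle
          + eLpNorm (fun x : AddCircle T => Complex.I * F₂.eval (toCircle x : ℂ)) (.ofReal p)
            haarAddCircle) + eLpNorm (fun _ : AddCircle T => a₀) (.ofReal p) haarAddCircle :=
        (eLpNorm_add_le (hF₁c.add hF₂c).aestronglyMeasurable aestronglyMeasurable_const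
          hp1').trans (by
            gcongr
            exact eLpNorm_add_le hF₁c.aestronglyMeasurable hF₂c.aestronglyMeasurable hp1')
    _ ≤ C * eLpNorm g (.ofReal p) haarAddCircle + C * eLpNorm g (.ofReal p) haarAddCircle
          + eLpNorm g (.ofReal p) haarAddCircle := by
        gcongr
        refine le_trans (eLpNorm_mono fun x => ?_) h₂
        simp
    _ = _ := by push_cast; ring

/-- Modulation by `fourier m` carries the Riesz projection to the projection on the frequencies
`≥ m`, which therefore obeys the same bound. -/
theorem exists_eLpNorm_fourier_tail_le {p : ℝ} (hp1 : 1 < p) (hp2 : p ≤ 2) :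
    ∃ C : ℝ≥0, ∀ (T : ℝ) [Fact (0 < T)] (s : Finset ℤ) (c : ℤ → ℂ) (m : ℤ),
      eLpNorm (fun x : AddCircle T => ∑ k ∈ s with m ≤ k, c k * fourier k x) (.ofReal p)
        haarAddCircle ≤
      C * eLpNorm (fun x : AddCircle T => ∑ k ∈ s, c k * fourier k x) (.ofReal p)
        haarAddCircle := by
  obtain ⟨C, hC⟩ := Polynomial.exists_eLpNorm_le_add_conj hp1 hp2
  refine ⟨C, fun T _ s c m => ?_⟩
  -- multiplication by `fourier m` turns polynomials in `toCircle` and conjugates of such into tails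
  set A : Polynomial ℂ := ∑ k ∈ s with m ≤ k, .C (c k) * .X ^ (k - m).toNat with hA
  set B : Polynomial ℂ := ∑ k ∈ s with ¬ m ≤ k, .C (conj (c k)) * .X ^ (m - k).toNat with hB
  have hpow : ∀ (x : AddCircle T) (n : ℕ), (toCircle x : ℂ) ^ n = fourier n x := fun x n => by
    simp [AddCircle.toCircle_nsmul]
  have hAe : ∀ x : AddCircle T, ∑ k ∈ s with m ≤ k, c k * fourier k x
      = fourier m x * A.eval (toCircle x : ℂ) := fun x => by
    rw [hA, Polynomial.eval_finsetSum, Finset.mul_sum]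
    refine Finset.sum_congr rfl fun k hk => ?_
    have hk' : m ≤ k := (Finset.mem_filter.1 hk).2
    have : fourier k x = fourier m x * fourier (k - m) x := by
      rw [← fourier_add]; congr 2; ring
    rw [Polynomial.eval_mul, Polynomial.eval_C, Polynomial.eval_pow, Polynomial.eval_X, hpow,
      Int.toNat_of_nonneg (by omega), this]
    ring
  have hBe : ∀ x : AddCircle T, ∑ k ∈ s with ¬ m ≤ k, c k * fourier k x
      = fourier m x * conj (B.eval (toCircle x : ℂ)) := fun x => by
    rw [hB, Polynomial.eval_finsetSum, map_sum, Finset.mul_sum]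
    refine Finset.sum_congr rfl fun k hk => ?_
    have hk' : ¬ m ≤ k := (Finset.mem_filter.1 hk).2
    have : fourier k x = fourier m x * fourier (-(m - k)) x := by
      rw [← fourier_add]; congr 2; ring
    rw [Polynomial.eval_mul, Polynomial.eval_C, Polynomial.eval_pow, Polynomial.eval_X, hpow,
      Int.toNat_of_nonneg (by omega), this, fourier_neg, map_mul, Complex.conj_conj]
    ring
  have hB0 : B.eval 0 = 0 := by
    rw [hB, Polynomial.eval_finsetSum]
    refine Finset.sum_eq_zero fun k hk => ?_
    have hk' : ¬ m ≤ k := (Finset.mem_filter.1 hk).2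
    simp only [Polynomial.eval_mul, Polynomial.eval_pow, Polynomial.eval_X]
    rw [zero_pow (by omega), mul_zero]
  have hnorm : ∀ x : AddCircle T, ‖fourier m x‖ = 1 := fun x => Circle.norm_coe _
  refine le_trans (le_of_eq ?_) ((hC T A B hB0).trans (le_of_eq ?_))
  · refine eLpNorm_congr_norm_ae (.of_forall fun x => ?_)
    simp only [hAe, norm_mul, hnorm, one_mul]
  · congr 1
    refine eLpNorm_congr_norm_ae (.of_forall fun x => ?_)
    simp only [← Finset.sum_filter_add_sum_filter_not s (m ≤ ·), hAe, hBe, ← mul_add, norm_mul,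
      hnorm, one_mul]

/-- The symmetric partial sum of degree `N` of the Fourier series of `f` on the circle; it is zero
for negative `N`. -/
noncomputable def fourierPartialSum {T : ℝ} [Fact (0 < T)] (N : ℤ) (f : AddCircle T → ℂ)
    (x : AddCircle T) : ℂ :=
  ∑ k ∈ Finset.Icc (-N) N, fourierCoeff f k * fourier k x

section PartialSum

variable {T : ℝ} [Fact (0 < T)]

theorem continuous_fourierPartialSum (N : ℤ) (f : AddCircle T → ℂ) :
    Continuous (fourierPartialSum N f) :=
  continuous_finsetSum _ fun k _ => continuous_const.mul (fourier k).continuous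

theorem fourierPartialSum_sub (N : ℤ) {f g : AddCircle T → ℂ} (hf : Integrable f haarAddCircle)
    (hg : Integrable g haarAddCircle) :
    fourierPartialSum N (f - g) = fourierPartialSum N f - fourierPartialSum N g := by
  ext x
  simp only [fourierPartialSum, Pi.sub_apply, ← Finset.sum_sub_distrib, ← sub_mul]
  refine Finset.sum_congr rfl fun k _ => ?_
  congr 1
  simp only [fourierCoeff, Pi.sub_apply, smul_sub]
  exact integral_sub (hf.fourier_smul _) (hg.fourier_smul _)

theorem fourierCoeff_trigPolynomial (s : Finset ℤ) (c : ℤ → ℂ) (k : ℤ) :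
    fourierCoeff (fun x : AddCircle T => ∑ j ∈ s, c j * fourier j x) k
      = if k ∈ s then c k else 0 := by
  have h : (fun x : AddCircle T => ∑ j ∈ s, c j * fourier j x)
      = ∑ j ∈ s, fun x : AddCircle T => c j * fourier j x := by
    ext x; simp
  rw [h, fourierCoeff.sum]
  · simp only [Finset.sum_apply, fourierCoeff.const_mul, fourierCoeff_fourier, Pi.single_apply,
      mul_ite, mul_one, mul_zero, Finset.sum_ite_eq]
  · intro j _
    exact memLp_one_iff_integrable.1
      ((continuous_const.mul (fourier j).continuous).memLp_haarAddCircle 1)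

theorem fourierPartialSum_trigPolynomial (N : ℤ) (s : Finset ℤ) (c : ℤ → ℂ) (x : AddCircle T) :
    fourierPartialSum N (fun x : AddCircle T => ∑ j ∈ s, c j * fourier j x) x
      = ∑ k ∈ s with k ∈ Finset.Icc (-N) N, c k * fourier k x := by
  simp only [fourierPartialSum, fourierCoeff_trigPolynomial, ite_mul, zero_mul]
  rw [← Finset.sum_filter]
  refine Finset.sum_congr ?_ fun _ _ => rfl
  ext k; simp only [Finset.mem_filter]; tauto

end PartialSum

/-! ### Partial sums on `L ^ p` for `1 < p ≤ 2` -/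

theorem exists_trigPolynomial_eLpNorm_sub_lt {T : ℝ} [Fact (0 < T)] {p : ℝ≥0∞} (hp1 : 1 ≤ p)
    (hp : p ≠ ∞) {f : AddCircle T → ℂ} (hf : MemLp f p haarAddCircle) {ε : ℝ≥0∞} (hε : ε ≠ 0) :
    ∃ (s : Finset ℤ) (c : ℤ → ℂ),
      eLpNorm (f - fun x => ∑ k ∈ s, c k * fourier k x) p haarAddCircle < ε := by
  have : Fact (1 ≤ p) := ⟨hp1⟩
  have hcl : hf.toLp f ∈ (Submodule.span ℂ (Set.range (@fourierLp T _ p _))).topologicalClosure := by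
    rw [span_fourierLp_closure_eq_top hp]; trivial
  obtain ⟨g, hg, hfg⟩ := EMetric.mem_closure_iff.1 hcl ε (pos_iff_ne_zero.2 hε)
  obtain ⟨c, rfl⟩ := Finsupp.mem_span_range_iff_exists_finsupp.1 hg
  refine ⟨c.support, c, ?_⟩
  have hsum : c.sum (fun k a => a • @fourierLp T _ p _ k)
      = ContinuousMap.toLp (E := ℂ) p haarAddCircle ℂ (∑ k ∈ c.support, c k • fourier k) := by
    simp only [Finsupp.sum, fourierLp, map_sum, map_smul]
  rw [Lp.edist_def] at hfg
  refine lt_of_eq_of_lt (eLpNorm_congr_ae ?_) hfg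
  rw [hsum]
  filter_upwards [hf.coeFn_toLp, ContinuousMap.coeFn_toLp (p := p) (𝕜 := ℂ) haarAddCircle
    (∑ k ∈ c.support, c k • fourier (T := T) k)] with x h1 h2
  rw [Pi.sub_apply, Pi.sub_apply, h1, h2]
  simp

/-- A bound that depends on `N`; it only serves to pass to the limit for fixed `N`. -/
theorem eLpNorm_fourierPartialSum_le_card {T : ℝ} [Fact (0 < T)] {p : ℝ≥0∞} (hp1 : 1 ≤ p)
    {f : AddCircle T → ℂ} (hf : AEStronglyMeasurable f haarAddCircle) (N : ℤ) :
    eLpNorm (fourierPartialSum N f) p haarAddCircle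
      ≤ (Finset.Icc (-N) N).card * eLpNorm f p haarAddCircle := by
  have hcoeff : ∀ k, ‖fourierCoeff f k‖ₑ ≤ eLpNorm f p haarAddCircle := fun k => by
    refine (enorm_integral_haarAddCircle_le hp1
      ((fourier (-k)).continuous.aestronglyMeasurable.smul hf)).trans_eq ?_
    refine eLpNorm_congr_norm_ae (.of_forall fun x => ?_)
    have : ‖fourier (-k) x‖ = 1 := Circle.norm_coe _
    change ‖fourier (-k) x • f x‖ = ‖f x‖
    rw [norm_smul, this, one_mul]
  have hbound : ∀ x, ‖fourierPartialSum N f x‖ₑ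
      ≤ (Finset.Icc (-N) N).card * eLpNorm f p haarAddCircle := fun x => by
    refine (enorm_sum_le _ _).trans ?_
    rw [← nsmul_eq_mul]
    refine Finset.sum_le_card_nsmul _ _ _ fun k _ => ?_
    have : ‖fourier k x‖ₑ = 1 := by
      rw [← ofReal_norm, show ‖fourier k x‖ = 1 from Circle.norm_coe _, ENNReal.ofReal_one]
    rw [enorm_mul, this, mul_one]
    exact hcoeff k
  refine (eLpNorm_le_of_ae_enorm_bound (.of_forall hbound)).trans_eq ?_
  simp

/-- **M. Riesz's theorem** for `1 < p ≤ 2`: the partial sum operators are bounded on `L ^ p`,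
uniformly in the degree and in the period. -/
theorem exists_eLpNorm_fourierPartialSum_le_of_le_two {p : ℝ} (hp1 : 1 < p) (hp2 : p ≤ 2) :
    ∃ C : ℝ≥0, ∀ (T : ℝ) [Fact (0 < T)] (N : ℤ) (f : AddCircle T → ℂ),
      MemLp f (.ofReal p) haarAddCircle →
      eLpNorm (fourierPartialSum N f) (.ofReal p) haarAddCircle
        ≤ C * eLpNorm f (.ofReal p) haarAddCircle := by
  obtain ⟨C, hC⟩ := exists_eLpNorm_fourier_tail_le hp1 hp2
  have hp1' : 1 ≤ ENNReal.ofReal p := by simpa using hp1.le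
  refine ⟨2 * C, fun T _ N f hf => ?_⟩
  rcases lt_or_ge N 0 with hN | hN
  · have : fourierPartialSum N f = 0 := by
      ext x; simp [fourierPartialSum, Finset.Icc_eq_empty (show ¬ -N ≤ N by omega)]
    simp [this]
  have htrig : ∀ (s : Finset ℤ) (c : ℤ → ℂ),
      eLpNorm (fourierPartialSum N fun x : AddCircle T => ∑ k ∈ s, c k * fourier k x) (.ofReal p)
        haarAddCircle ≤ (2 * C : ℝ≥0) *
      eLpNorm (fun x : AddCircle T => ∑ k ∈ s, c k * fourier k x) (.ofReal p) haarAddCircle := by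
    intro s c
    have hcont : ∀ t : Finset ℤ, Continuous fun x : AddCircle T => ∑ k ∈ t, c k * fourier k x :=
      fun t => continuous_finsetSum _ fun k _ => continuous_const.mul (fourier k).continuous
    have h : (fourierPartialSum N fun x : AddCircle T => ∑ k ∈ s, c k * fourier k x)
        = (fun x : AddCircle T => ∑ k ∈ s with -N ≤ k, c k * fourier k x)
          - fun x => ∑ k ∈ s with N + 1 ≤ k, c k * fourier k x := by
      ext x
      rw [fourierPartialSum_trigPolynomial, Pi.sub_apply, eq_sub_iff_add_eq,
        ← Finset.sum_union]
      · refine Finset.sum_congr ?_ fun _ _ => rfl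
        ext k
        simp only [Finset.mem_union, Finset.mem_filter, Finset.mem_Icc]
        constructor
        · rintro (h | h) <;> exact ⟨h.1, by omega⟩
        · rintro ⟨h1, h2⟩
          by_cases h3 : k ≤ N
          · exact Or.inl ⟨h1, h2, h3⟩
          · exact Or.inr ⟨h1, by omega⟩
      · refine Finset.disjoint_filter.2 fun k _ h => ?_
        rw [Finset.mem_Icc] at h
        omega
    rw [h]
    refine (eLpNorm_sub_le (hcont _).aestronglyMeasurable (hcont _).aestronglyMeasurable
      hp1').trans ((add_le_add (hC T s c _) (hC T s c _)).trans_eq ?_)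
    push_cast; ring
  -- approximation by trigonometric polynomials, with the crude bound for the error
  set D : ℝ≥0 := (Finset.Icc (-N) N).card + 2 * C with hD
  have key : ∀ ε : ℝ≥0, 0 < ε → eLpNorm (fourierPartialSum N f) (.ofReal p) haarAddCircle
      ≤ (2 * C : ℝ≥0) * eLpNorm f (.ofReal p) haarAddCircle + D * ε := by
    intro ε hε
    obtain ⟨s, c, hsc⟩ := exists_trigPolynomial_eLpNorm_sub_lt hp1' ENNReal.ofReal_ne_top hf
      (ε := ε) (by simpa using hε.ne')
    set g : AddCircle T → ℂ := fun x => ∑ k ∈ s, c k * fourier k x with hg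
    have hgc : Continuous g :=
      continuous_finsetSum _ fun k _ => continuous_const.mul (fourier k).continuous
    have hgL := hgc.memLp_haarAddCircle (.ofReal p)
    have hsplit : fourierPartialSum N f = fourierPartialSum N (f - g) + fourierPartialSum N g := by
      rw [fourierPartialSum_sub N (hf.integrable hp1') (hgL.integrable hp1')]; abel
    have hgle : eLpNorm g (.ofReal p) haarAddCircle ≤ eLpNorm f (.ofReal p) haarAddCircle + ε := by
      have : g = f - (f - g) := by abel
      rw [this]
      refine (eLpNorm_sub_le hf.1 (hf.1.sub hgL.1) hp1').trans ?_
      gcongr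
    calc _ ≤ eLpNorm (fourierPartialSum N (f - g)) (.ofReal p) haarAddCircle
          + eLpNorm (fourierPartialSum N g) (.ofReal p) haarAddCircle := by
          rw [hsplit]
          exact eLpNorm_add_le (continuous_fourierPartialSum _ _).aestronglyMeasurable
            (continuous_fourierPartialSum _ _).aestronglyMeasurable hp1'
      _ ≤ (Finset.Icc (-N) N).card * ε
          + (2 * C : ℝ≥0) * (eLpNorm f (.ofReal p) haarAddCircle + ε) := by
          gcongr
          · refine (eLpNorm_fourierPartialSum_le_card hp1' (hf.1.sub hgL.1) N).trans ?_
            gcongr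
          · refine (htrig s c).trans ?_
            gcongr
      _ = _ := by rw [hD]; push_cast; ring
  have hlim : Tendsto (fun ε : ℝ≥0 => ((2 * C : ℝ≥0) : ℝ≥0∞) * eLpNorm f (.ofReal p) haarAddCircle
      + (D * ε : ℝ≥0)) (𝓝[>] 0)
      (𝓝 ((2 * C : ℝ≥0) * eLpNorm f (.ofReal p) haarAddCircle + (D * 0 : ℝ≥0))) := by
    refine tendsto_const_nhds.add (ENNReal.tendsto_coe.2 ?_)
    exact (tendsto_const_nhds.mul tendsto_id).mono_left nhdsWithin_le_nhds
  simp only [mul_zero, ENNReal.coe_zero, add_zero] at hlim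
  refine ge_of_tendsto hlim (eventually_nhdsWithin_of_forall fun ε hε => ?_)
  simpa using key ε hε

/-- The partial sum operators are symmetric for the bilinear pairing `(f, g) ↦ ∫ f g`. -/
theorem integral_fourierPartialSum_mul {T : ℝ} [Fact (0 < T)] (N : ℤ) {f g : AddCircle T → ℂ}
    (hf : Integrable f haarAddCircle) (hg : Integrable g haarAddCircle) :
    ∫ x, fourierPartialSum N f x * g x ∂haarAddCircle
      = ∫ x, f x * fourierPartialSum N g x ∂haarAddCircle := by
  have h1 : ∀ k, ∫ x, fourierCoeff f k * fourier k x * g x ∂haarAddCircle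
      = fourierCoeff f k * fourierCoeff g (-k) := fun k => by
    simp only [mul_assoc, integral_const_mul]
    simp [fourierCoeff]
  have h2 : ∀ k, ∫ x, f x * (fourierCoeff g k * fourier k x) ∂haarAddCircle
      = fourierCoeff f (-k) * fourierCoeff g k := fun k => by
    have : ∀ x, f x * (fourierCoeff g k * fourier k x)
        = fourier (- -k) x • f x * fourierCoeff g k := fun x => by
      rw [neg_neg, smul_eq_mul]; ring
    simp only [this, integral_mul_const]
    rfl
  simp only [fourierPartialSum, Finset.sum_mul, Finset.mul_sum]
  rw [integral_finsetSum, integral_finsetSum]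
  · simp only [h1, h2]
    refine Finset.sum_bij' (fun k _ => -k) (fun k _ => -k) ?_ ?_ ?_ ?_ ?_ <;>
      simp only [Finset.mem_Icc, neg_neg, implies_true] <;> intros <;> omega
  · intro k _
    refine ((hf.fourier_smul k).mul_const (fourierCoeff g k)).congr (.of_forall fun x => ?_)
    simp only [smul_eq_mul]; ring
  · intro k _
    refine ((hg.fourier_smul k).const_mul (fourierCoeff f k)).congr (.of_forall fun x => ?_)
    simp only [smul_eq_mul]; ring

/-! ### M. Riesz's theorem, on the circle and on intervals -/

/-- **M. Riesz's theorem** for `1 < p < ∞`: the exponents `p > 2` follow by duality. -/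
theorem exists_eLpNorm_fourierPartialSum_le {p : ℝ} (hp1 : 1 < p) :
    ∃ C : ℝ≥0, ∀ (T : ℝ) [Fact (0 < T)] (N : ℤ) (f : AddCircle T → ℂ),
      MemLp f (.ofReal p) haarAddCircle →
      eLpNorm (fourierPartialSum N f) (.ofReal p) haarAddCircle
        ≤ C * eLpNorm f (.ofReal p) haarAddCircle := by
  rcases le_or_gt p 2 with hp2 | hp2
  · exact exists_eLpNorm_fourierPartialSum_le_of_le_two hp1 hp2
  have hp0 : 0 < p := by linarith
  have hpq : p.HolderConjugate (p / (p - 1)) := Real.HolderConjugate.conjExponent hp1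
  obtain ⟨q, hq⟩ : ∃ q, q = p / (p - 1) := ⟨_, rfl⟩
  rw [← hq] at hpq
  have hq2 : q ≤ 2 := by
    rw [hq, div_le_iff₀ (by linarith)]; linarith
  obtain ⟨C, hC⟩ := exists_eLpNorm_fourierPartialSum_le_of_le_two hpq.symm.lt hq2
  refine ⟨C, fun T _ N f hf => ?_⟩
  have hp1' : 1 ≤ ENNReal.ofReal p := by simpa using hp1.le
  set h := fourierPartialSum N f with hh
  have hhc : Continuous h := continuous_fourierPartialSum N f
  -- `g` satisfies `h g = |h| ^ p` and `|g| ^ q = |h| ^ p`, the equality case of Hölder's inequality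
  set g : AddCircle T → ℂ := fun x => conj (h x) * ((‖h x‖ ^ (p - 2) : ℝ) : ℂ) with hg
  have hgc : Continuous g := (Complex.continuous_conj.comp hhc).mul
    (Complex.continuous_ofReal.comp (hhc.norm.rpow_const fun x => Or.inr (by linarith)))
  set I : ℝ := ∫ x, ‖h x‖ ^ p ∂haarAddCircle with hI
  have hI0 : 0 ≤ I := integral_nonneg fun _ => by positivity
  have hnorm_h : eLpNorm h (.ofReal p) haarAddCircle = .ofReal (I ^ p⁻¹) :=
    hhc.eLpNorm_haarAddCircle hp0
  have hmul : ∀ x, h x * g x = ((‖h x‖ ^ p : ℝ) : ℂ) := fun x => by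
    rw [hg, ← mul_assoc, Complex.mul_conj, ← Complex.ofReal_mul, Complex.normSq_eq_norm_sq]
    congr 1
    rcases eq_or_ne (h x) 0 with h0 | h0
    · simp [h0, Real.zero_rpow hp0.ne']
    · rw [← Real.rpow_natCast, ← Real.rpow_add (norm_pos_iff.2 h0)]
      norm_num
  have hnorm_g : eLpNorm g (.ofReal q) haarAddCircle = .ofReal (I ^ q⁻¹) := by
    rw [hgc.eLpNorm_haarAddCircle hpq.symm.pos, hI]
    suffices ∀ x, ‖g x‖ ^ q = ‖h x‖ ^ p by simp only [this]
    intro x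
    have hgx : ‖g x‖ = ‖h x‖ ^ (p - 1) := by
      rw [hg, norm_mul, RCLike.norm_conj, Complex.norm_real, Real.norm_eq_abs,
        abs_of_nonneg (by positivity)]
      rcases eq_or_ne (h x) 0 with h0 | h0
      · simp [h0, Real.zero_rpow (by linarith : p - 1 ≠ 0)]
      · nth_rw 1 [← Real.rpow_one ‖h x‖]
        rw [← Real.rpow_add (norm_pos_iff.2 h0)]
        ring_nf
    have : (p - 1) * q = p := by
      rw [hq]; field_simp [(by linarith : p - 1 ≠ 0)]
    rw [hgx, ← Real.rpow_mul (norm_nonneg _), this]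
  have hgL := hgc.memLp_haarAddCircle (.ofReal q)
  have key : ENNReal.ofReal I
      ≤ eLpNorm f (.ofReal p) haarAddCircle * (C * ENNReal.ofReal (I ^ q⁻¹)) := by
    have e1 : ((I : ℝ) : ℂ) = ∫ x, f x * fourierPartialSum N g x ∂haarAddCircle := by
      rw [← integral_fourierPartialSum_mul N (hf.integrable hp1')
        (hgL.integrable (by simpa using hpq.symm.lt.le)), hI]
      refine (integral_ofReal (𝕜 := ℂ)).symm.trans ?_
      exact integral_congr_ae (.of_forall fun x => (hmul x).symm)
    have e2 : ENNReal.ofReal I = ‖((I : ℝ) : ℂ)‖ₑ := by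
      rw [← ofReal_norm, Complex.norm_real, Real.norm_eq_abs, abs_of_nonneg hI0]
    have : ENNReal.HolderConjugate (.ofReal p) (.ofReal q) := hpq.ennrealOfReal
    have hSg := continuous_fourierPartialSum N g
    rw [e2, e1]
    calc _ ≤ eLpNorm (f • fourierPartialSum N g) 1 haarAddCircle :=
          enorm_integral_haarAddCircle_le le_rfl (hf.1.smul hSg.aestronglyMeasurable)
      _ ≤ eLpNorm f (.ofReal p) haarAddCircle
            * eLpNorm (fourierPartialSum N g) (.ofReal q) haarAddCircle :=
          eLpNorm_smul_le_mul_eLpNorm hSg.aestronglyMeasurable hf.1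
      _ ≤ _ := by
          gcongr
          rw [← hnorm_g]
          exact hC T N g hgL
  rw [hnorm_h]
  rcases hI0.eq_or_lt with h0 | h0
  · rw [← h0, Real.zero_rpow (inv_ne_zero hp0.ne')]
    simp
  · have hsplit : ENNReal.ofReal I = ENNReal.ofReal (I ^ p⁻¹) * ENNReal.ofReal (I ^ q⁻¹) := by
      rw [← ENNReal.ofReal_mul (by positivity), ← Real.rpow_add h0, hpq.inv_add_inv_eq_one,
        Real.rpow_one]
    rw [hsplit] at key
    have hne : ENNReal.ofReal (I ^ q⁻¹) ≠ 0 := by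
      simpa using Real.rpow_pos_of_pos h0 _
    rw [← ENNReal.mul_le_mul_iff_left hne ENNReal.ofReal_ne_top]
    refine key.trans_eq (by ring)

section Interval

variable {τ : ℝ}

theorem fourierCoeff_liftIoc_eq_fourierCoeffInterval [Fact (0 < 2 * τ)] (f : ℝ → ℂ) (k : ℤ) :
    fourierCoeff (AddCircle.liftIoc (2 * τ) (-τ) f) k = fourierCoeffInterval f τ k := by
  have hT : 0 < 2 * τ := Fact.out
  rw [fourierCoeff_eq_intervalIntegral _ _ (-τ), fourierCoeffInterval,
    show -τ + 2 * τ = τ by ring]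
  rw [Complex.real_smul]
  congr 1
  · push_cast; rfl
  · rw [intervalIntegral.integral_of_le (by linarith), intervalIntegral.integral_of_le (by linarith)]
    refine setIntegral_congr_fun measurableSet_Ioc fun x hx => ?_
    rw [AddCircle.liftIoc_coe_apply (by rwa [show -τ + 2 * τ = τ by ring]), fourier_coe_apply,
      smul_eq_mul, mul_comm]
    congr 2
    have : (τ : ℂ) ≠ 0 := by exact_mod_cast (by linarith : τ ≠ 0)
    push_cast
    field_simp

theorem fourierPartialSum_liftIoc_eq_trigSum [Fact (0 < 2 * τ)] (σ : ℝ) (f : ℝ → ℂ) (x : ℝ) :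
    fourierPartialSum ⌊σ * τ / Real.pi⌋ (AddCircle.liftIoc (2 * τ) (-τ) f) (x : AddCircle (2 * τ))
      = trigSum σ f τ x := by
  have hT : 0 < 2 * τ := Fact.out
  refine Finset.sum_congr rfl fun k _ => ?_
  rw [fourierCoeff_liftIoc_eq_fourierCoeffInterval, fourier_coe_apply]
  congr 2
  have : (τ : ℂ) ≠ 0 := by exact_mod_cast (by linarith : τ ≠ 0)
  push_cast
  field_simp

theorem continuous_trigSum (σ : ℝ) (f : ℝ → ℂ) (τ : ℝ) : Continuous (trigSum σ f τ) := by
  unfold trigSum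
  fun_prop

/-- M. Riesz's theorem on `[-τ, τ]`: the operators `f ↦ f_τ` are bounded on `L ^ p`, uniformly in
`σ` and `τ`. -/
theorem exists_eLpNorm_trigSum_le {p : ℝ≥0∞} (hp1 : 1 < p) (hp : p < ∞) :
    ∃ C : ℝ≥0, ∀ (σ τ : ℝ) (f : ℝ → ℂ), 0 < τ → MemLp f p (volume.restrict (Set.Icc (-τ) τ)) →
      eLpNorm (trigSum σ f τ) p (volume.restrict (Set.Icc (-τ) τ))
        ≤ C * eLpNorm f p (volume.restrict (Set.Icc (-τ) τ)) := by
  have hp1' : 1 < p.toReal := by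
    rw [← ENNReal.toReal_one]; exact (ENNReal.toReal_lt_toReal ENNReal.one_ne_top hp.ne).2 hp1
  obtain ⟨C, hC⟩ := exists_eLpNorm_fourierPartialSum_le hp1'
  rw [ENNReal.ofReal_toReal hp.ne] at hC
  refine ⟨C, fun σ τ f hτ hf => ?_⟩
  have hT : Fact (0 < 2 * τ) := ⟨by linarith⟩
  have hμ : volume.restrict (Set.Icc (-τ) τ) = volume.restrict (Set.Ioc (-τ) (-τ + 2 * τ)) := by
    rw [show -τ + 2 * τ = τ by ring]
    exact (Measure.restrict_congr_set Ioc_ae_eq_Icc).symm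
  rw [hμ] at hf ⊢
  set F := AddCircle.liftIoc (2 * τ) (-τ) f with hF
  have hFL : MemLp F p (haarAddCircle (T := 2 * τ)) := hf.memLp_liftIoc.haarAddCircle
  have hvol : ∀ {G : AddCircle (2 * τ) → ℂ}, AEStronglyMeasurable G volume →
      eLpNorm (fun x : ℝ => G x) p (volume.restrict (Set.Ioc (-τ) (-τ + 2 * τ)))
        = ENNReal.ofReal (2 * τ) ^ p.toReal⁻¹ * eLpNorm G p haarAddCircle := fun {G} hG => by
    refine (eLpNorm_comp_measurePreserving hG
      (AddCircle.measurePreserving_mk (2 * τ) (-τ))).trans ?_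
    rw [AddCircle.volume_eq_smul_haarAddCircle]
    rw [eLpNorm_smul_measure_of_ne_top hp.ne, smul_eq_mul, one_div, ENNReal.toReal_inv]
  have h1 : eLpNorm f p (volume.restrict (Set.Ioc (-τ) (-τ + 2 * τ)))
      = eLpNorm (fun x : ℝ => F x) p (volume.restrict (Set.Ioc (-τ) (-τ + 2 * τ))) := by
    refine eLpNorm_congr_ae ?_
    filter_upwards [ae_restrict_mem measurableSet_Ioc] with x hx
    rw [hF, AddCircle.liftIoc_coe_apply hx]
  have h2 : trigSum σ f τ = fun x : ℝ => fourierPartialSum ⌊σ * τ / Real.pi⌋ F x := by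
    ext x; rw [hF, fourierPartialSum_liftIoc_eq_trigSum]
  rw [h1, h2, hvol hf.memLp_liftIoc.1,
    hvol (continuous_fourierPartialSum _ _).aestronglyMeasurable, mul_left_comm]
  gcongr
  exact hC _ _ F hFL

theorem trigSum_sub (σ : ℝ) {f g : ℝ → ℂ} (hf : IntegrableOn f (Set.Icc (-τ) τ))
    (hg : IntegrableOn g (Set.Icc (-τ) τ)) (hτ : 0 < τ) :
    trigSum σ (f - g) τ = trigSum σ f τ - trigSum σ g τ := by
  ext x
  have hint : ∀ {h : ℝ → ℂ}, IntegrableOn h (Set.Icc (-τ) τ) → ∀ k : ℤ, IntervalIntegrable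
      (fun t => h t * Complex.exp (-(Complex.I * (Real.pi / τ) * k * t))) volume (-τ) τ :=
    fun hh k => ((intervalIntegrable_iff_integrableOn_Icc_of_le (by linarith)).2 hh).mul_continuousOn
      (by fun_prop)
  simp only [trigSum, Pi.sub_apply, ← Finset.sum_sub_distrib, ← sub_mul]
  refine Finset.sum_congr rfl fun k _ => ?_
  congr 1
  simp only [fourierCoeffInterval, Pi.sub_apply, ← mul_sub, sub_mul]
  rw [intervalIntegral.integral_sub (hint hf k) (hint hg k)]

/-- The sum `f_τ` reproduces trigonometric polynomials of degree at most `⌊σ τ / π⌋`. -/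
theorem trigSum_trigPolynomial (σ : ℝ) (hτ : 0 < τ) (c : ℤ → ℂ) (x : ℝ) :
    trigSum σ (fun x : ℝ => ∑ k ∈ Finset.Icc (-⌊σ * τ / Real.pi⌋) ⌊σ * τ / Real.pi⌋,
      c k * fourier k (x : AddCircle (2 * τ))) τ x
      = ∑ k ∈ Finset.Icc (-⌊σ * τ / Real.pi⌋) ⌊σ * τ / Real.pi⌋,
          c k * fourier k (x : AddCircle (2 * τ)) := by
  have hT : Fact (0 < 2 * τ) := ⟨by linarith⟩
  have hlift : AddCircle.liftIoc (2 * τ) (-τ)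
      (fun x : ℝ => ∑ k ∈ Finset.Icc (-⌊σ * τ / Real.pi⌋) ⌊σ * τ / Real.pi⌋,
        c k * fourier k (x : AddCircle (2 * τ)))
      = fun y => ∑ k ∈ Finset.Icc (-⌊σ * τ / Real.pi⌋) ⌊σ * τ / Real.pi⌋, c k * fourier k y := by
    ext y
    obtain ⟨y, hy, rfl⟩ : y ∈ ((↑) : ℝ → AddCircle (2 * τ)) '' Set.Ioc (-τ) (-τ + 2 * τ) := by
      rw [AddCircle.coe_image_Ioc_eq]; trivial
    rw [AddCircle.liftIoc_coe_apply hy]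
  rw [← fourierPartialSum_liftIoc_eq_trigSum, hlift, fourierPartialSum_trigPolynomial,
    Finset.filter_mem_eq_inter, Finset.inter_self]

end Interval

/-! ### Bandlimited Schwartz functions and Poisson summation -/

section Poisson

/-- The dilation `x ↦ G (a x)` of a Schwartz function. -/
noncomputable def SchwartzMap.dilate (G : 𝓢(ℝ, ℂ)) {a : ℝ} (ha : a ≠ 0) : 𝓢(ℝ, ℂ) :=
  SchwartzMap.compCLMOfContinuousLinearEquiv ℂ
    (ContinuousLinearEquiv.unitsEquivAut ℝ (Units.mk0 a ha)) G

theorem SchwartzMap.dilate_apply (G : 𝓢(ℝ, ℂ)) {a : ℝ} (ha : a ≠ 0) (x : ℝ) :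
    G.dilate ha x = G (a * x) := by
  simp [dilate, mul_comm]

theorem SchwartzMap.fourier_dilate (G : 𝓢(ℝ, ℂ)) {a : ℝ} (ha : 0 < a) (w : ℝ) :
    𝓕 (G.dilate ha.ne') w = (a⁻¹ : ℝ) • 𝓕 G (w / a) := by
  rw [SchwartzMap.fourier_coe, SchwartzMap.fourier_coe, Real.fourier_eq', Real.fourier_eq']
  have := Measure.integral_comp_mul_left (fun v : ℝ =>
    Complex.exp (↑(-2 * Real.pi * inner ℝ v (w / a)) * Complex.I) • G v) a
  rw [abs_of_pos (inv_pos.2 ha)] at this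
  rw [← this]
  congr 1
  ext v
  rw [dilate_apply]
  congr 5
  simp
  field_simp

/-- Poisson summation: the `2τ`-periodization of a Schwartz function bandlimited to `[-σ, σ]` is a
trigonometric polynomial of degree at most `⌊σ τ / π⌋`. In the normalization of `𝓕` the band is
`[-σ / 2π, σ / 2π]`. -/
theorem SchwartzMap.tsum_comp_add_mul_eq_sum (G : 𝓢(ℝ, ℂ)) {σ τ : ℝ} (hτ : 0 < τ)
    (hG : ∀ w, σ / (2 * Real.pi) < |w| → 𝓕 G w = 0) (x : ℝ) :
    ∑' m : ℤ, G (x + 2 * τ * m) =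
      ∑ k ∈ Finset.Icc (-⌊σ * τ / Real.pi⌋) ⌊σ * τ / Real.pi⌋,
        (((2 * τ)⁻¹ : ℝ) • 𝓕 G (k / (2 * τ))) * fourier k (x : AddCircle (2 * τ)) := by
  have hT : 0 < 2 * τ := by linarith
  have h1 : ∀ m : ℤ, G (x + 2 * τ * m) = G.dilate hT.ne' (x / (2 * τ) + m) := fun m => by
    rw [SchwartzMap.dilate_apply]; congr 1; field_simp
  have h2 : ∀ k : ℤ, fourier k ((x / (2 * τ) : ℝ) : UnitAddCircle)
      = fourier k (x : AddCircle (2 * τ)) := fun k => by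
    rw [fourier_coe_apply, fourier_coe_apply]; push_cast; congr 1; ring
  simp_rw [h1, SchwartzMap.tsum_eq_tsum_fourier, h2, SchwartzMap.fourier_dilate _ hT]
  refine tsum_eq_sum fun k hk => ?_
  rw [hG, smul_zero, zero_mul]
  have hk' : ⌊σ * τ / Real.pi⌋ < |k| := by
    rw [Finset.mem_Icc, ← abs_le] at hk
    exact not_le.1 hk
  rw [Int.floor_lt] at hk'
  rw [abs_div, abs_of_pos hT, div_lt_div_iff₀ (by positivity) hT]
  rw [div_lt_iff₀ Real.pi_pos] at hk'
  push_cast at hk'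
  linarith

/-- On `[-τ, τ]` a Schwartz function is uniformly close to its `2τ`-periodization. -/
theorem SchwartzMap.exists_norm_sub_tsum_le (G : 𝓢(ℝ, ℂ)) :
    ∃ K : ℝ, 0 ≤ K ∧ ∀ τ : ℝ, 0 < τ → ∀ x ∈ Set.Icc (-τ) τ,
      ‖G x - ∑' m : ℤ, G (x + 2 * τ * m)‖ ≤ K / τ ^ 2 := by
  obtain ⟨K, -, hK⟩ := G.decay 2 0
  have hK' : ∀ y, y ^ 2 * ‖G y‖ ≤ K := fun y => by simpa using hK y
  have hK0 : 0 ≤ K := le_trans (by positivity) (hK' 0)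
  have hS : Summable fun m : ℤ => 1 / (m : ℝ) ^ 2 := Real.summable_one_div_int_pow.2 one_lt_two
  refine ⟨K * ∑' m : ℤ, 1 / (m : ℝ) ^ 2, by positivity, fun τ hτ x hx => ?_⟩
  have hb : ∀ m : ℤ, m ≠ 0 → ‖G (x + 2 * τ * m)‖ ≤ K / τ ^ 2 * (1 / (m : ℝ) ^ 2) := fun m hm => by
    have hm1 : (1 : ℝ) ≤ |(m : ℝ)| := by exact_mod_cast Int.one_le_abs hm
    have hx' : |x| ≤ τ := abs_le.2 hx
    have h1 : τ * |(m : ℝ)| ≤ |x + 2 * τ * m| := by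
      have h2 : |2 * τ * m| ≤ |x + 2 * τ * m| + |x| := by
        simpa using abs_sub (x + 2 * τ * m) x
      rw [abs_mul, abs_of_pos (by linarith : 0 < 2 * τ)] at h2
      nlinarith
    have h3 : τ ^ 2 * (m : ℝ) ^ 2 ≤ (x + 2 * τ * m) ^ 2 := by
      rw [← sq_abs (m : ℝ), ← sq_abs (x + _), ← mul_pow]
      gcongr
    have hm0 : (0 : ℝ) < (m : ℝ) ^ 2 := by positivity
    rw [div_mul_div_comm, mul_one, le_div_iff₀ (by positivity), mul_comm]
    exact (mul_le_mul_of_nonneg_right h3 (norm_nonneg _)).trans (hK' _)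
  have hS' := hS.mul_left (K / τ ^ 2)
  have hsum : Summable fun m : ℤ => G (x + 2 * τ * m) := by
    refine Summable.of_norm_bounded_eventually hS' ?_
    filter_upwards [(Set.finite_singleton (0 : ℤ)).compl_mem_cofinite] with m hm
    exact hb m hm
  rw [hsum.tsum_eq_add_tsum_ite 0]
  simp only [Int.cast_zero, mul_zero, add_zero, sub_add_cancel_left, norm_neg]
  refine (tsum_of_norm_bounded hS'.hasSum fun m => ?_).trans_eq ?_
  · split_ifs with h
    · rw [norm_zero]; positivity
    · exact hb m h
  · rw [tsum_mul_left]; ring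

/-- The convergence for bandlimited Schwartz functions `G`: with `P` the `2τ`-periodization,
`P_τ = P`, so `G - G_τ = (G - P) - (G - P)_τ`, and `G - P` is `O(τ⁻²)` on `[-τ, τ]`. -/
theorem SchwartzMap.tendsto_eLpNorm_sub_trigSum {p : ℝ≥0∞} (hp1 : 1 < p) (hp : p < ∞)
    (G : 𝓢(ℝ, ℂ)) {σ : ℝ} (hG : ∀ w, σ / (2 * Real.pi) < |w| → 𝓕 G w = 0) :
    Tendsto (fun τ : ℝ => eLpNorm (⇑G - trigSum σ G τ) p (volume.restrict (Set.Icc (-τ) τ)))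
      atTop (𝓝 0) := by
  obtain ⟨C, hC⟩ := exists_eLpNorm_trigSum_le hp1 hp
  obtain ⟨K, hK0, hK⟩ := G.exists_norm_sub_tsum_le
  have hlim : Tendsto (fun τ : ℝ => (1 + C : ℝ≥0∞) * ENNReal.ofReal (2 * K / τ)) atTop (𝓝 0) := by
    have h : Tendsto (fun τ : ℝ => ENNReal.ofReal (2 * K / τ)) atTop (𝓝 0) := by
      rw [← ENNReal.ofReal_zero]
      exact ENNReal.tendsto_ofReal (tendsto_const_nhds.div_atTop tendsto_id)
    simpa using ENNReal.Tendsto.const_mul h (Or.inr (by finiteness : (1 + C : ℝ≥0∞) ≠ ∞))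
  refine tendsto_of_tendsto_of_tendsto_of_le_of_le' tendsto_const_nhds hlim
    (.of_forall fun _ => zero_le) ?_
  filter_upwards [eventually_ge_atTop 1] with τ hτ
  have hτ0 : 0 < τ := by linarith
  -- the periodization of `G`, a trigonometric polynomial
  set P : ℝ → ℂ := fun x => ∑ k ∈ Finset.Icc (-⌊σ * τ / Real.pi⌋) ⌊σ * τ / Real.pi⌋,
        (((2 * τ)⁻¹ : ℝ) • 𝓕 G (k / (2 * τ))) * fourier k (x : AddCircle (2 * τ)) with hP
  have hPc : Continuous P := continuous_finsetSum _ fun k _ => continuous_const.mul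
    ((fourier k).continuous.comp (AddCircle.continuous_mk' _))
  have hGP : ∀ x ∈ Set.Icc (-τ) τ, ‖(⇑G - P) x‖ ≤ K / τ ^ 2 := fun x hx => by
    have := hK τ hτ0 x hx
    rwa [G.tsum_comp_add_mul_eq_sum hτ0 hG] at this
  have hGPc : Continuous (⇑G - P) := G.continuous.sub hPc
  have hbound : eLpNorm (⇑G - P) p (volume.restrict (Set.Icc (-τ) τ))
      ≤ ENNReal.ofReal (2 * K / τ) := by
    refine (eLpNorm_le_of_ae_bound (C := K / τ ^ 2) ?_).trans ?_
    · filter_upwards [ae_restrict_mem measurableSet_Icc] with x hx using hGP x hx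
    · rw [Measure.restrict_apply_univ, Real.volume_Icc, show τ - -τ = 2 * τ by ring]
      have h1 : ENNReal.ofReal (2 * τ) ^ p.toReal⁻¹ ≤ ENNReal.ofReal (2 * τ) := by
        nth_rw 2 [← ENNReal.rpow_one (ENNReal.ofReal (2 * τ))]
        refine ENNReal.rpow_le_rpow_of_exponent_le (ENNReal.one_le_ofReal.2 (by linarith)) ?_
        refine inv_le_one_of_one_le₀ ?_
        rw [← ENNReal.toReal_one]
        exact ENNReal.toReal_mono hp.ne hp1.le
      refine (mul_le_mul_left h1 _).trans_eq ?_
      rw [← ENNReal.ofReal_mul (by positivity)]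
      congr 1
      field_simp
  have hPL : MemLp (⇑G - P) p (volume.restrict (Set.Icc (-τ) τ)) :=
    MemLp.of_bound hGPc.aestronglyMeasurable (K / τ ^ 2) <| by
      filter_upwards [ae_restrict_mem measurableSet_Icc] with x hx using hGP x hx
  have hsplit : ⇑G - trigSum σ G τ = (⇑G - P) - trigSum σ (⇑G - P) τ := by
    rw [trigSum_sub σ G.continuous.integrableOn_Icc hPc.integrableOn_Icc hτ0,
      show trigSum σ P τ = P from funext fun x => trigSum_trigPolynomial σ hτ0 _ x]
    abel
  rw [hsplit]
  calc _ ≤ _ := eLpNorm_sub_le hPL.1 (continuous_trigSum _ _ _).aestronglyMeasurable hp1.le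
    _ ≤ _ := add_le_add le_rfl (hC σ τ _ hτ0 hPL)
    _ ≤ (1 + C) * ENNReal.ofReal (2 * K / τ) := by
      rw [add_mul, one_mul]
      gcongr

end Poisson

/-! ### Spectral support and Schwartz regularity -/

theorem exists_schwartz_tsupport_subset_closedBall_integral_eq_one :
    ∃ Φ : 𝓢(ℝ, ℂ), tsupport Φ ⊆ Metric.closedBall 0 1 ∧ ∫ x, Φ x = 1 := by
  let b : ContDiffBump (0 : ℝ) := ⟨1 / 2, 1, by norm_num, by norm_num⟩
  have hsupp : HasCompactSupport fun x => ((b.normed volume x : ℝ) : ℂ) :=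
    b.hasCompactSupport_normed.comp_left Complex.ofReal_zero
  refine ⟨hsupp.toSchwartzMap (Complex.ofRealCLM.contDiff.comp b.contDiff_normed), ?_, ?_⟩
  · refine subset_trans ?_ (b.tsupport_normed_eq (μ := volume)).subset
    refine closure_mono fun x hx => ?_
    have hx' : ((b.normed volume x : ℝ) : ℂ) ≠ 0 := hx
    simpa using hx'
  · change ∫ x, ((b.normed volume x : ℝ) : ℂ) = 1
    rw [integral_complex_ofReal, b.integral_normed, Complex.ofReal_one]

/-- A test function supported in `[c - r, c + r]`, namely `φ t = r⁻¹ Φ ((t - c) / r)`, and its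
Fourier transform. -/
theorem SchwartzMap.exists_angularFourier_eq (Φ : 𝓢(ℝ, ℂ))
    (hΦ : tsupport Φ ⊆ Metric.closedBall 0 1) {r : ℝ} (hr : 0 < r) (c : ℝ) :
    ∃ φ : 𝓢(ℝ, ℂ), tsupport φ ⊆ Metric.closedBall c r ∧ ∀ y, angularFourier φ y
      = Complex.exp (-(Complex.I * c * y)) * 𝓕 Φ (r * y / (2 * Real.pi)) := by
  set φ : ℝ → ℂ := fun t => r⁻¹ * Φ ((t - c) / r) with hφ
  have hzero : ∀ t, t ∉ Metric.closedBall c r → φ t = 0 := fun t ht => by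
    have : Φ ((t - c) / r) = 0 := by
      refine image_eq_zero_of_notMem_tsupport fun h => ht ?_
      have := hΦ h
      rw [mem_closedBall_zero_iff, norm_div, Real.norm_eq_abs r, abs_of_pos hr,
        div_le_one hr] at this
      rwa [mem_closedBall_iff_norm]
    simp [hφ, this]
  have hcomp : HasCompactSupport φ := .intro (isCompact_closedBall c r) hzero
  have hsmooth : ContDiff ℝ (⊤ : ℕ∞) φ :=
    contDiff_const.mul ((Φ.smooth ⊤).comp ((contDiff_id.sub contDiff_const).div_const r))
  refine ⟨hcomp.toSchwartzMap hsmooth, ?_, fun y => ?_⟩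
  · refine closure_minimal (fun t ht => ?_) Metric.isClosed_closedBall
    by_contra h
    exact ht (hzero t h)
  · set F : ℝ → ℂ := fun u => Φ u * Complex.exp (-(Complex.I * y * (r * u + c))) with hF
    have h1 : ∀ t, φ t * Complex.exp (-(Complex.I * y * t)) = r⁻¹ * F ((t - c) / r) := fun t => by
      have : (r : ℂ) ≠ 0 := by exact_mod_cast hr.ne'
      simp only [hφ, hF]
      push_cast
      rw [mul_assoc]
      congr 4
      field_simp
      ring
    have h2 : ∀ u, F u = Complex.exp (-(Complex.I * c * y)) *
        (Complex.exp (↑(-2 * Real.pi * inner ℝ u (r * y / (2 * Real.pi))) * Complex.I) • Φ u) :=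
      fun u => by
        have hπ : (Real.pi : ℂ) ≠ 0 := by exact_mod_cast Real.pi_ne_zero
        have hexp : -(Complex.I * c * y)
            + ↑(-2 * Real.pi * inner ℝ u (r * y / (2 * Real.pi))) * Complex.I
            = -(Complex.I * y * (r * u + c)) := by
          simp only [RCLike.inner_apply, conj_trivial]
          push_cast
          field_simp
          ring
        rw [smul_eq_mul, ← mul_assoc, ← Complex.exp_add, hexp, mul_comm]
    calc ∫ t : ℝ, φ t * Complex.exp (-(Complex.I * y * t))
        = r⁻¹ * ∫ t : ℝ, F ((t - c) / r) := by
          simp only [h1, integral_const_mul]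
      _ = ∫ u, F u := by
          rw [integral_sub_right_eq_self (fun t => F (t / r)) c, Measure.integral_comp_div,
            abs_of_pos hr, Complex.real_smul, ← mul_assoc, ← Complex.ofReal_mul,
            inv_mul_cancel₀ hr.ne', Complex.ofReal_one, one_mul]
      _ = _ := by
          simp only [h2, integral_const_mul]
          rw [SchwartzMap.fourier_coe, Real.fourier_eq']

theorem IsBandlimited.integral_mul_eq_zero {σ : ℝ} {f : ℝ → ℂ} (hf : IsBandlimited σ f)
    {Φ : 𝓢(ℝ, ℂ)} (hΦ : tsupport Φ ⊆ Metric.closedBall 0 1) {r c : ℝ} (hr : 0 < r)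
    (hc : σ + r < |c|) :
    ∫ y : ℝ, f y * (Complex.exp (-(Complex.I * c * y)) * 𝓕 Φ (r * y / (2 * Real.pi))) = 0 := by
  obtain ⟨φ, hφ, hφ'⟩ := Φ.exists_angularFourier_eq hΦ hr c
  simp only [← hφ']
  refine hf φ (hφ.trans fun t ht h => ?_)
  rw [mem_closedBall_iff_norm, Real.norm_eq_abs] at ht
  have h1 : |t| ≤ σ := abs_le.2 h
  have h2 : |c| ≤ |t| + |t - c| := by
    have := abs_sub t (t - c)
    rwa [sub_sub_cancel] at this
  linarith

/-- A rapidly decreasing integrable function whose Fourier transform has compact support is a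
Schwartz function almost everywhere: its Fourier transform is smooth, hence Schwartz, and can be
inverted. -/
theorem exists_schwartz_ae_eq_of_fourier_eq_zero {g : ℝ → ℂ}
    (hg : ∀ n : ℕ, Integrable fun x => ‖x‖ ^ n * ‖g x‖) (hgm : AEStronglyMeasurable g)
    {ρ : ℝ} (hρ : ∀ w, ρ < |w| → 𝓕 g w = 0) :
    ∃ G : 𝓢(ℝ, ℂ), g =ᵐ[volume] G ∧ ∀ w, ρ < |w| → 𝓕 G w = 0 := by
  have hgi : Integrable g := (integrable_norm_iff hgm).1 (by simpa using hg 0)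
  have hsmooth : ContDiff ℝ (⊤ : ℕ∞) (𝓕 g) := Real.contDiff_fourier (N := ⊤) fun n _ => hg n
  have hcomp : HasCompactSupport (𝓕 g) :=
    .intro (isCompact_closedBall 0 ρ) fun w hw => hρ w (by simpa using hw)
  set H : 𝓢(ℝ, ℂ) := hcomp.toSchwartzMap hsmooth with hH
  have hHe : ∀ w, H w = 𝓕 g w := fun w => rfl
  refine ⟨𝓕⁻ H, ?_, fun w hw => ?_⟩
  · refine ae_eq_of_integral_contDiff_smul_eq hgi.locallyIntegrable
      (𝓕⁻ H).integrable.locallyIntegrable fun u hu hu' => ?_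
    have hsupp : HasCompactSupport fun x => (u x : ℂ) := hu'.comp_left Complex.ofReal_zero
    set U : 𝓢(ℝ, ℂ) := hsupp.toSchwartzMap (Complex.ofRealCLM.contDiff.comp hu) with hU
    -- write `U` as the Fourier transform of `V`
    set V : 𝓢(ℝ, ℂ) := 𝓕⁻ U with hV
    have hUV : 𝓕 V = U := FourierTransform.fourier_fourierInv_eq U
    have hUe : ∀ x, (u x : ℂ) = 𝓕 V x := fun x => by rw [hUV]; rfl
    have h1 : ∫ x, g x * 𝓕 V x = ∫ w, 𝓕 g w * V w := by
      have := VectorFourier.integral_fourierIntegral_smul_eq_flip (L := innerₗ ℝ)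
        Real.continuous_fourierChar continuous_inner hgi V.integrable (μ := volume) (ν := volume)
      simpa [flip_innerₗ] using! this.symm
    have h2 : ∫ x, (𝓕⁻ H) x * 𝓕 V x = ∫ w, H w * V w := by
      rw [← SchwartzMap.integral_fourier_mul_eq, FourierTransform.fourier_fourierInv_eq]
    simp only [Complex.real_smul, hUe, mul_comm (𝓕 V _)]
    rw [h1, h2]
    rfl
  · rw [FourierTransform.fourier_fourierInv_eq]
    exact hρ w hw

/-! ### Density of bandlimited Schwartz functions in the Bernstein space -/

theorem aestronglyMeasurable_comp_mul_left {u : ℝ → ℂ} (hu : AEStronglyMeasurable u) {a : ℝ}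
    (ha : a ≠ 0) : AEStronglyMeasurable fun x => u (a * x) :=
  hu.comp_quasiMeasurePreserving ⟨measurable_const_mul a, by
    rw [Real.map_volume_mul_left ha]
    exact Measure.smul_absolutelyContinuous⟩

theorem eLpNorm_comp_mul_left_le {p : ℝ≥0∞} (hp1 : 1 ≤ p) (hp : p ≠ ∞) {u : ℝ → ℂ}
    (hu : AEStronglyMeasurable u) {a : ℝ} (ha : 1 / 2 ≤ a) :
    eLpNorm (fun x => u (a * x)) p ≤ 2 * eLpNorm u p := by
  have ha0 : 0 < a := by linarith
  have hmap := Real.map_volume_mul_left ha0.ne'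
  have hu' : AEStronglyMeasurable u (Measure.map (a * ·) volume) := by
    rw [hmap]; exact hu.smul_measure _
  have h := eLpNorm_map_measure (p := p) hu' (measurable_const_mul a).aemeasurable
  rw [hmap, eLpNorm_smul_measure_of_ne_top hp, smul_eq_mul] at h
  refine h.symm.trans_le ?_
  gcongr
  have h2 : ENNReal.ofReal |a⁻¹| ≤ 2 := by
    rw [abs_of_pos (by positivity), ← ENNReal.ofReal_ofNat]
    refine ENNReal.ofReal_le_ofReal ?_
    rw [inv_le_comm₀ ha0 two_pos]
    linarith
  have h3 : (1 / p).toReal ≤ 1 := by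
    rw [← ENNReal.toReal_one]
    exact ENNReal.toReal_mono ENNReal.one_ne_top (by simpa using hp1)
  calc _ ≤ (2 : ℝ≥0∞) ^ (1 / p).toReal := by gcongr
    _ ≤ (2 : ℝ≥0∞) ^ (1 : ℝ) := ENNReal.rpow_le_rpow_of_exponent_le one_le_two h3
    _ = 2 := ENNReal.rpow_one _

theorem eventually_eLpNorm_sub_dilate_mul_le_of_hasCompactSupport {p : ℝ≥0∞} {h : ℝ → ℂ}
    (hc : Continuous h) (hs : HasCompactSupport h) {Ψ : ℝ → ℂ} (hΨ : Continuous Ψ)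
    (hΨ0 : Ψ 0 = 1) (κ : ℝ) {ε : ℝ≥0∞} (hε : ε ≠ 0) :
    ∀ᶠ s in 𝓝 (0 : ℝ), eLpNorm (fun x => h x - h ((1 - s) * x) * Ψ (κ * s * x)) p ≤ ε := by
  obtain ⟨R, hR⟩ := hs.isCompact.isBounded.subset_closedBall 0
  have hzero : ∀ x, R < |x| → h x = 0 := fun x hx =>
    image_eq_zero_of_notMem_tsupport fun hmem => by
      have := hR hmem
      rw [mem_closedBall_zero_iff, Real.norm_eq_abs] at this
      linarith
  set K : Set ℝ := Metric.closedBall 0 (2 * R) with hK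
  have hKc : IsCompact K := isCompact_closedBall _ _
  have hmeas : volume K ^ p.toReal⁻¹ ≠ ∞ :=
    ENNReal.rpow_ne_top_of_nonneg (inv_nonneg.2 ENNReal.toReal_nonneg) hKc.measure_ne_top
  obtain ⟨η, hη0, hη⟩ : ∃ η : ℝ≥0, 0 < η ∧ volume K ^ p.toReal⁻¹ * η < ε := by
    have hlim : Tendsto (fun η : ℝ≥0 => volume K ^ p.toReal⁻¹ * (η : ℝ≥0∞)) (𝓝[>] 0) (𝓝 0) := by
      have : Tendsto (fun η : ℝ≥0 => (η : ℝ≥0∞)) (𝓝[>] 0) (𝓝 0) :=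
        (ENNReal.tendsto_coe.2 tendsto_id).mono_left nhdsWithin_le_nhds
      simpa using ENNReal.Tendsto.const_mul this (Or.inr hmeas)
    have h1 := hlim.eventually (gt_mem_nhds (pos_iff_ne_zero.2 hε))
    obtain ⟨η, h2, h3⟩ := (h1.and self_mem_nhdsWithin).exists
    exact ⟨η, h3, h2⟩
  have hunif : ∀ᶠ s in 𝓝 (0 : ℝ), ∀ x ∈ K, ‖h x - h ((1 - s) * x) * Ψ (κ * s * x)‖ < η := by
    refine hKc.eventually_forall_of_forall_eventually fun x _ => ?_
    have hcont : Continuous fun z : ℝ × ℝ =>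
        ‖h z.2 - h ((1 - z.1) * z.2) * Ψ (κ * z.1 * z.2)‖ := by fun_prop
    refine hcont.continuousAt.eventually (gt_mem_nhds ?_)
    simpa [hΨ0] using hη0
  filter_upwards [hunif, Metric.ball_mem_nhds (0 : ℝ) (by norm_num : (0 : ℝ) < 1 / 2)] with s hsη hs2
  have hs2' : 1 / 2 ≤ 1 - s := by
    rw [mem_ball_zero_iff, Real.norm_eq_abs] at hs2
    linarith [(abs_lt.1 hs2).2]
  have hsupp : Function.support (fun x => h x - h ((1 - s) * x) * Ψ (κ * s * x)) ⊆ K := by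
    intro x hx
    by_contra hxK
    rw [hK, mem_closedBall_zero_iff, Real.norm_eq_abs, not_le] at hxK
    refine hx ?_
    have h1 : R < |x| := by linarith [abs_nonneg x]
    have h2 : R < |(1 - s) * x| := by
      rw [abs_mul, abs_of_pos (by linarith : 0 < 1 - s)]
      nlinarith [abs_nonneg x]
    simp only [hzero _ h1, hzero _ h2, zero_mul, sub_zero]
  rw [← eLpNorm_restrict_eq_of_support_subset hsupp]
  refine (eLpNorm_le_of_ae_bound (C := η) ?_).trans ?_
  · filter_upwards [ae_restrict_mem hKc.measurableSet] with x hx using (hsη x hx).le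
  · rw [Measure.restrict_apply_univ, ENNReal.ofReal_coe_nnreal]
    exact hη.le

theorem MeasureTheory.MemLp.eventually_eLpNorm_sub_dilate_mul_le {p : ℝ≥0∞} (hp1 : 1 ≤ p)
    (hp : p ≠ ∞) {f : ℝ → ℂ} (hf : MemLp f p) (Ψ : 𝓢(ℝ, ℂ)) (hΨ0 : Ψ 0 = 1) (κ : ℝ) {ε : ℝ≥0∞} (hε : ε ≠ 0) :
    ∀ᶠ s in 𝓝 (0 : ℝ), eLpNorm (fun x => f x - f ((1 - s) * x) * Ψ (κ * s * x)) p ≤ ε := by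
  obtain ⟨M, hM0, hM⟩ : ∃ M : ℝ≥0, 0 < M ∧ ∀ x, ‖Ψ x‖ ≤ M := by
    obtain ⟨M, hM0, hM⟩ := Ψ.decay 0 0
    exact ⟨⟨M, hM0.le⟩, hM0, fun x => (by simpa using hM x : ‖Ψ x‖ ≤ M)⟩
  -- the constants in front of the approximation error add up to `D`
  set D : ℝ≥0∞ := 1 + M * 2 + 1 with hD
  have hD0 : D ≠ 0 := by positivity
  have hDt : D ≠ ∞ := by rw [hD]; finiteness
  have hη : ε / D ≠ 0 := ENNReal.div_ne_zero.2 ⟨hε, hDt⟩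
  obtain ⟨h, hs, hfh, hc, hL⟩ := hf.exists_hasCompactSupport_eLpNorm_sub_le hp hη
  filter_upwards [eventually_eLpNorm_sub_dilate_mul_le_of_hasCompactSupport (p := p) hc hs
    Ψ.continuous hΨ0 κ hη, Metric.ball_mem_nhds (0 : ℝ) (by norm_num : (0 : ℝ) < 1 / 2)]
    with s hsη hs2
  have hs2' : 1 / 2 ≤ 1 - s := by
    rw [mem_ball_zero_iff, Real.norm_eq_abs] at hs2
    linarith [(abs_lt.1 hs2).2]
  have hum : AEStronglyMeasurable (f - h) := hf.1.sub hL.1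
  have hΨc : Continuous fun x => Ψ (κ * s * x) := Ψ.continuous.comp (continuous_const_mul _)
  have hdil : AEStronglyMeasurable fun x => (f - h) ((1 - s) * x) * Ψ (κ * s * x) :=
    (aestronglyMeasurable_comp_mul_left hum (by linarith : 1 - s ≠ 0)).mul
      hΨc.aestronglyMeasurable
  have hhm : AEStronglyMeasurable fun x => h x - h ((1 - s) * x) * Ψ (κ * s * x) :=
    (hc.sub ((hc.comp (continuous_const_mul _)).mul hΨc)).aestronglyMeasurable
  have h1 : eLpNorm (fun x => (f - h) ((1 - s) * x) * Ψ (κ * s * x)) p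
      ≤ M * (2 * (ε / D)) := by
    calc _ ≤ ENNReal.ofReal M * eLpNorm (fun x => (f - h) ((1 - s) * x)) p := by
          refine eLpNorm_le_mul_eLpNorm_of_ae_le_mul (.of_forall fun x => ?_) p
          rw [norm_mul, mul_comm]
          gcongr
          exact hM _
      _ ≤ _ := by
          rw [ENNReal.ofReal_coe_nnreal]
          gcongr
          exact (eLpNorm_comp_mul_left_le hp1 hp hum hs2').trans (by gcongr)
  have hsplit : (fun x => f x - f ((1 - s) * x) * Ψ (κ * s * x))
      = ((f - h) - fun x => (f - h) ((1 - s) * x) * Ψ (κ * s * x))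
        + fun x => h x - h ((1 - s) * x) * Ψ (κ * s * x) := by
    ext x; simp only [Pi.add_apply, Pi.sub_apply]; ring
  rw [hsplit]
  calc _ ≤ _ := eLpNorm_add_le (hum.sub hdil) hhm hp1
    _ ≤ _ := add_le_add (eLpNorm_sub_le hum hdil hp1) le_rfl
    _ ≤ ε / D + M * (2 * (ε / D)) + ε / D := by gcongr
    _ = D * (ε / D) := by rw [hD]; ring
    _ = ε := ENNReal.mul_div_cancel hD0 hDt

/-- The dilation by `1 - s` shrinks the band to `[-(1 - s) σ, (1 - s) σ]`, and the multiplication by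
the window, whose Fourier transform lives on frequencies of size at most `s σ`, enlarges it again
to `[-σ, σ]` at most. -/
theorem IsBandlimited.fourier_dilate_mul_eq_zero {σ : ℝ} (hσ : 0 < σ) {f : ℝ → ℂ}
    (hf : IsBandlimited σ f) {Φ : 𝓢(ℝ, ℂ)} (hΦ : tsupport Φ ⊆ Metric.closedBall 0 1) {s : ℝ}
    (hs0 : 0 < s) (hs1 : s < 1) {w : ℝ} (hw : σ / (2 * Real.pi) < |w|) :
    𝓕 (fun x => f ((1 - s) * x) * 𝓕 Φ (σ / (2 * Real.pi) * s * x)) w = 0 := by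
  have hl : 0 < 1 - s := by linarith
  have hπ := Real.pi_pos
  have key := hf.integral_mul_eq_zero hΦ (r := s * σ / (1 - s)) (c := 2 * Real.pi * w / (1 - s))
    (by positivity) (by
      rw [abs_div, abs_mul, abs_of_pos hl, abs_of_pos (by positivity : 0 < 2 * Real.pi),
        lt_div_iff₀ hl, add_mul, div_mul_cancel₀ _ hl.ne']
      rw [div_lt_iff₀ (by positivity)] at hw
      nlinarith)
  have hsub := Measure.integral_comp_mul_left (fun y : ℝ => f y *
    (Complex.exp (-(Complex.I * ↑(2 * Real.pi * w / (1 - s)) * y))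
      * 𝓕 Φ (s * σ / (1 - s) * y / (2 * Real.pi)))) (1 - s)
  rw [key, smul_zero] at hsub
  rw [Real.fourier_eq', ← hsub]
  congr 1
  ext x
  have e1 : s * σ / (1 - s) * ((1 - s) * x) / (2 * Real.pi) = σ / (2 * Real.pi) * s * x := by
    field_simp
  have e2 : (↑(-2 * Real.pi * inner ℝ x w) * Complex.I : ℂ)
      = -(Complex.I * ↑(2 * Real.pi * w / (1 - s)) * ↑((1 - s) * x)) := by
    have : (1 - s : ℂ) ≠ 0 := by exact_mod_cast hl.ne'
    simp only [RCLike.inner_apply, conj_trivial]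
    push_cast
    field_simp
  rw [e1, e2, smul_eq_mul]
  ring

theorem SchwartzMap.integrable_pow_mul_norm_mul {p : ℝ≥0∞} (hp1 : 1 ≤ p) {u : ℝ → ℂ}
    (hu : MemLp u p) (Ψ : 𝓢(ℝ, ℂ)) (n : ℕ) : Integrable fun x => ‖x‖ ^ n * ‖u x * Ψ x‖ := by
  have : p.HolderConjugate (ENNReal.conjExponent p) := .conjExponent hp1
  have hg : (fun x : ℝ => x ^ n).HasTemperateGrowth := by fun_prop
  have h := (hu.mul' ((SchwartzMap.smulLeftCLM ℂ (fun x : ℝ => x ^ n) Ψ).memLp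
    (ENNReal.conjExponent p)) (r := 1))
  refine (memLp_one_iff_integrable.1 h).norm.congr (.of_forall fun x => ?_)
  simp only [SchwartzMap.smulLeftCLM_apply_apply hg, norm_mul, norm_smul, norm_pow]
  ring

/-- Bandlimited Schwartz functions are dense in the Bernstein space. -/
theorem MemBernstein.exists_schwartz_eLpNorm_sub_le {p : ℝ≥0∞} (hp1 : 1 ≤ p) (hp : p ≠ ∞) {σ : ℝ}
    (hσ : 0 < σ) {f : ℝ → ℂ} (hf : MemBernstein p σ f) {ε : ℝ≥0∞} (hε : ε ≠ 0) :
    ∃ G : 𝓢(ℝ, ℂ), (∀ w, σ / (2 * Real.pi) < |w| → 𝓕 G w = 0) ∧ eLpNorm (f - ⇑G) p ≤ ε := by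
  obtain ⟨Φ, hΦ, hΦ1⟩ := exists_schwartz_tsupport_subset_closedBall_integral_eq_one
  have hΨ0 : 𝓕 Φ 0 = 1 := by
    rw [SchwartzMap.fourier_coe, Real.fourier_eq']
    simpa using hΦ1
  have hev := hf.memLp.eventually_eLpNorm_sub_dilate_mul_le hp1 hp (𝓕 Φ) hΨ0
    (σ / (2 * Real.pi)) hε
  obtain ⟨s, ⟨hsε, hs2⟩, hs0⟩ := (((hev.and (gt_mem_nhds one_half_pos)).filter_mono
    nhdsWithin_le_nhds).and (self_mem_nhdsWithin (s := Set.Ioi (0 : ℝ)))).exists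
  have hs0 : 0 < s := hs0
  have hs1 : s < 1 := by linarith
  have hπ := Real.pi_pos
  have hκ : σ / (2 * Real.pi) * s ≠ 0 := by positivity
  have hmul : ∀ x, 𝓕 Φ (σ / (2 * Real.pi) * s * x) = (𝓕 Φ).dilate hκ x := fun x =>
    ((𝓕 Φ).dilate_apply hκ x).symm
  have hfL : MemLp (fun x => f ((1 - s) * x)) p :=
    ⟨aestronglyMeasurable_comp_mul_left hf.memLp.1 (by linarith),
      (eLpNorm_comp_mul_left_le hp1 hp hf.memLp.1 (by linarith)).trans_lt
        (ENNReal.mul_lt_top (by finiteness) hf.memLp.2)⟩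
  obtain ⟨G, hG, hG0⟩ := exists_schwartz_ae_eq_of_fourier_eq_zero
    (g := fun x => f ((1 - s) * x) * 𝓕 Φ (σ / (2 * Real.pi) * s * x))
    (fun n => by
      simp only [hmul]
      exact SchwartzMap.integrable_pow_mul_norm_mul hp1 hfL _ n)
    (by
      simp only [hmul]
      exact hfL.1.mul (SchwartzMap.continuous _).aestronglyMeasurable)
    fun w hw => hf.isBandlimited.fourier_dilate_mul_eq_zero hσ hΦ hs0 hs1 hw
  refine ⟨G, hG0, le_trans (eLpNorm_congr_ae ?_).le hsε⟩
  filter_upwards [hG] with x hx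
  rw [Pi.sub_apply, ← hx]

theorem MeasureTheory.MemLp.eventually_eLpNorm_indicator_compl_Icc_le {p : ℝ≥0∞} (hp : p ≠ ∞)
    {f : ℝ → ℂ}
    (hf : MemLp f p) {ε : ℝ≥0∞} (hε : ε ≠ 0) :
    ∀ᶠ τ : ℝ in atTop, eLpNorm ((Set.Icc (-τ) τ)ᶜ.indicator f) p ≤ ε := by
  obtain ⟨h, hs, hfh, -, -⟩ := hf.exists_hasCompactSupport_eLpNorm_sub_le hp hε
  obtain ⟨R, hR⟩ := hs.isCompact.isBounded.subset_closedBall 0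
  filter_upwards [eventually_ge_atTop R] with τ hτ
  refine le_trans (eLpNorm_mono fun x => ?_) hfh
  by_cases hx : x ∈ Set.Icc (-τ) τ
  · simp [hx]
  · have h0 : h x = 0 := by
      refine image_eq_zero_of_notMem_tsupport fun hmem => hx ?_
      have := hR hmem
      rw [mem_closedBall_zero_iff, Real.norm_eq_abs] at this
      exact abs_le.1 (this.trans hτ)
    simp [hx, h0]

end

/-! ### Convergence -/

theorem theorem1 (p : ℝ≥0∞) (hp1 : 1 < p) (hp : p < ∞) (σ : ℝ) (hσ : 0 < σ)
    (f : ℝ → ℂ) (hf : MemBernstein p σ f) :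
    Tendsto (fun τ : ℝ => eLpNorm (fun x => f x - truncatedTrigSum σ f τ x) p volume)
      atTop (𝓝 0) := by
  obtain ⟨C, hC⟩ := exists_eLpNorm_trigSum_le hp1 hp
  rw [ENNReal.tendsto_nhds_zero]
  intro ε hε
  have hD0 : (3 + C : ℝ≥0∞) ≠ 0 := by positivity
  have hDt : (3 + C : ℝ≥0∞) ≠ ∞ := by finiteness
  have hη : ε / (3 + C) ≠ 0 := ENNReal.div_ne_zero.2 ⟨hε.ne', hDt⟩
  obtain ⟨G, hG, hfG⟩ := hf.exists_schwartz_eLpNorm_sub_le hp1.le hp.ne hσ hη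
  have hlim := (ENNReal.tendsto_nhds_zero.1 (G.tendsto_eLpNorm_sub_trigSum hp1 hp hG)) _
    (pos_iff_ne_zero.2 hη)
  have htail : ∀ᶠ τ : ℝ in atTop, eLpNorm ((Set.Icc (-τ) τ)ᶜ.indicator f) p ≤ ε / (3 + C) :=
    hf.memLp.eventually_eLpNorm_indicator_compl_Icc_le hp.ne hη
  filter_upwards [hlim, htail, eventually_gt_atTop 0] with τ hτG hτtail hτ
  have hrest : ∀ {h : ℝ → ℂ}, MemLp h p → MemLp h p (volume.restrict (Set.Icc (-τ) τ)) :=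
    fun hh => hh.restrict _
  have hGL : MemLp G p := G.memLp p
  have hdL : MemLp (f - ⇑G) p := hf.memLp.sub hGL
  have hint : ∀ {h : ℝ → ℂ}, MemLp h p → IntegrableOn h (Set.Icc (-τ) τ) :=
    fun hh => (hrest hh).integrable hp1.le
  have hmeas : ∀ h, AEStronglyMeasurable (trigSum σ h τ) (volume.restrict (Set.Icc (-τ) τ)) :=
    fun h => (continuous_trigSum σ h τ).aestronglyMeasurable
  have hinside : eLpNorm (f - trigSum σ f τ) p (volume.restrict (Set.Icc (-τ) τ))
      ≤ ε / (3 + C) + C * (ε / (3 + C)) + ε / (3 + C) := by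
    have hsplit : f - trigSum σ f τ = ((f - ⇑G) - trigSum σ (f - ⇑G) τ) + (⇑G - trigSum σ G τ) := by
      rw [trigSum_sub σ (hint hf.memLp) (hint hGL) hτ]; abel
    rw [hsplit]
    refine (eLpNorm_add_le ((hrest hdL).1.sub (hmeas _)) ((hrest hGL).1.sub (hmeas _))
      hp1.le).trans ?_
    refine add_le_add ((eLpNorm_sub_le (hrest hdL).1 (hmeas _) hp1.le).trans ?_) hτG
    have h1 : eLpNorm (f - ⇑G) p (volume.restrict (Set.Icc (-τ) τ)) ≤ ε / (3 + C) :=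
      (eLpNorm_restrict_le _ _ _ _).trans hfG
    refine add_le_add h1 ((hC σ τ _ hτ (hrest hdL)).trans ?_)
    gcongr
  have hsum : (fun x => f x - truncatedTrigSum σ f τ x)
      = (Set.Icc (-τ) τ)ᶜ.indicator f + (Set.Icc (-τ) τ).indicator (f - trigSum σ f τ) := by
    ext x
    by_cases hx : x ∈ Set.Icc (-τ) τ
    · simp [truncatedTrigSum, hx]
    · simp [truncatedTrigSum, hx]
  rw [hsum]
  refine (eLpNorm_add_le (hf.memLp.1.indicator measurableSet_Icc.compl)
    ((hf.memLp.1.sub (continuous_trigSum σ f τ).aestronglyMeasurable).indicator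
      measurableSet_Icc) hp1.le).trans ?_
  rw [eLpNorm_indicator_eq_eLpNorm_restrict measurableSet_Icc (f := f - trigSum σ f τ)]
  calc _ ≤ ε / (3 + C) + (ε / (3 + C) + C * (ε / (3 + C)) + ε / (3 + C)) :=
        add_le_add hτtail hinside
    _ = (3 + C) * (ε / (3 + C)) := by ring
    _ = ε := ENNReal.mul_div_cancel hD0 hDt
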